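/- Let $n,m$ be positive integers, $\lambda>0$, let $\alpha_1,\dots,\alpha_n$ be linear forms on $\mathbb R^m$ and $\chi$ a unitary character of $\mathbb R^m$. Write $zw=\sum_k z_kw_k$ and $z^2=zz$ for $z,w\in\mathbb C^n$, and $z^{-1/2}$ for the principal determination. For $t\in\mathbb R^m$ let $A(t)=\mathrm{Diag}(e^{i\alpha_1(t)},\dots,e^{i\alpha_n(t)})$, $t\cdot z=A(t)z$ and $t^{-1}=-t$. Let $\mathcal F_\lambda$ be the Hilbert space of entire functions $f$ on $\mathbb C^n$ with $\|f\|_\lambda^2=\int_{\mathbb C^n}|f(z)|^2e^{-\lambda|z|^2/2}\,(\tfrac{\lambda}{2\pi})^n\,dm(z)<\infty$, where $dm$ is Lebesgue measure. For $(t,z_0,c_0)\in G=\mathbb R^m\times\mathbb C^n\times\mathbb R$ (the generalized diamond group) define operators on $\mathcal F_\lambda$ by $$(\sigma(t)f)(z)=\chi(t)f(t^{-1}\cdot z),\qquad (\rho(z_0,c_0)f)(z)=\exp\left(i\lambda c_0+\tfrac\lambda2\bar z_0z-\tfrac\lambda4|z_0|^2\right)f(z-z_0),$$ and $\pi(t,z_0,c_0)=\rho(z_0,c_0)\sigma(t)$.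 Let $\mathcal B$ be the Bargmann transform on $L^2(\mathbb R^n)$, $$(\mathcal B\phi)(z)=\left(\tfrac\lambda\pi\right)^{n/4}\int_{\mathbb R^n}\exp\left(-\tfrac\lambda4z^2+\lambda zx-\tfrac\lambda2x^2\right)\phi(x)\,dx .$$ Then $\mathcal B$ is a unitary isomorphism of $L^2(\mathbb R^n)$ onto $\mathcal F_\lambda$, and the operators $\sigma(t)$ and $\pi(g)$ map $\mathcal F_\lambda$ into itself; put $\sigma'(t)=\mathcal B^{-1}\sigma(t)\mathcal B$ and $\pi'(g)=\mathcal B^{-1}\pi(g)\mathcal B$. A measurable function $K$ on $\mathbb R^n\times\mathbb R^n$ is called the kernel of an operator $T$ on $L^2(\mathbb R^n)$ if $(T\phi)(x)=\int K(x,y)\phi(y)\,dy$ for almost every $x$, with absolute convergence, for all $\phi\in L^1\cap L^2$, and if $T\phi=\lim_{R\to\infty}\int_{|y|\le R}K(\cdot,y)\phi(y)\,dy$ in $L^2$ for all $\phi\in L^2$. Let $t\in\mathbb R^m$ be such that $\alpha_k(t)\notin\pi\mathbb Z$ for $k=1,\dots,n$. Then the kernel of $\sigma'(t)$ is $$b_t(x,y)=\left(\tfrac\lambda\pi\right)^{n/2}\chi(t)\,\det(I_n-A(t^{-1})^2)^{-1/2}\exp\left(\tfrac\lambda2(x^2+y^2)\right)$$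 $$\times\exp\left(\lambda\left(y(A(t^{-1})^2-I_n)^{-1}y-2xA(t^{-1})(A(t^{-1})^2-I_n)^{-1}y+x(A(t^{-1})^2-I_n)^{-1}x\right)\right),$$ where $\det(M)^{-1/2}$ denotes the product of the principal values $\mu^{-1/2}$ over the eigenvalues $\mu$ of $M$, counted with multiplicity; equivalently, $$b_t(x,y)=\left(\tfrac\lambda\pi\right)^{n/2}\chi(t)\prod_{k=1}^n(1-e^{-2i\alpha_k(t)})^{-1/2}\exp\left(\tfrac{i\lambda}2\sum_{k=1}^n\cot(\alpha_k(t))(x_k^2+y_k^2)-i\lambda\sum_{k=1}^n\frac{x_ky_k}{\sin\alpha_k(t)}\right).$$ Moreover, for $g=(t,a+ib,c)$ with $a,b\in\mathbb R^n$ and $c\in\mathbb R$, the kernel of $\pi'(g)$ is $$K_{\pi'(g)}(x,y)=\exp\left(i\lambda\left(c-bx+\tfrac12ab\right)\right)b_t(x-a,y).$$ -/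

import Mathlib

open MeasureTheory Filter Topology

noncomputable section

namespace Diamond

/-- `L²(ℝⁿ)` for Lebesgue measure. -/
abbrev L2 (n : ℕ) : Type := Lp ℂ 2 (volume : Measure (EuclideanSpace ℝ (Fin n)))

/-- The measure `e^{-λ|z|²/2} (λ/2π)ⁿ dm(z)` on `ℂⁿ`, where `dm` is Lebesgue measure `dx dy`. -/
def fockMeasure (n : ℕ) (lam : ℝ) : Measure (Fin n → ℂ) :=
  (volume : Measure (Fin n → ℂ)).withDensity fun z =>
    ENNReal.ofReal ((lam / (2 * Real.pi)) ^ n * Real.exp (-(lam / 2) * ∑ k, ‖z k‖ ^ 2))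

/-- The Fock space: entire functions on `ℂⁿ` that are square integrable for `fockMeasure`. -/
def fockSpace (n : ℕ) (lam : ℝ) : Submodule ℂ ((Fin n → ℂ) → ℂ) where
  carrier := {f | Differentiable ℂ f ∧ MemLp f 2 (fockMeasure n lam)}
  add_mem' hf hg := ⟨hf.1.add hg.1, hf.2.add hg.2⟩
  zero_mem' := ⟨differentiable_const 0, MemLp.zero⟩
  smul_mem' c _ hf := ⟨hf.1.const_smul c, hf.2.const_smul c⟩

/-- The inner product of the Fock space, linear in the first variable. -/
def fockInner (n : ℕ) (lam : ℝ) (f g : (Fin n → ℂ) → ℂ) : ℂ :=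
  ∫ z, f z * starRingEnd ℂ (g z) ∂(fockMeasure n lam)

/-- `B(z,x) = (λ/π)^{n/4} exp(-(λ/4) z² + λ z x - (λ/2) x²)`, where `zw = ∑ₖ zₖ wₖ`. -/
def bargmannKernel {n : ℕ} (lam : ℝ) (z : Fin n → ℂ) (x : EuclideanSpace ℝ (Fin n)) : ℂ :=
  (((lam / Real.pi) ^ ((n : ℝ) / 4) : ℝ) : ℂ) *
    Complex.exp (-(lam / 4) * ∑ k, z k ^ 2 + lam * ∑ k, z k * x k - (lam / 2) * ∑ k, (x k : ℂ) ^ 2)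

/-- The Bargmann transform. -/
def bargmann {n : ℕ} (lam : ℝ) (φ : L2 n) : (Fin n → ℂ) → ℂ :=
  fun z => ∫ x, bargmannKernel lam z x * φ x

/-- The inverse of the Bargmann transform: `bargmannInv lam f` is the `φ ∈ L²(ℝⁿ)` with
`bargmann lam φ = f`. -/
def bargmannInv {n : ℕ} (lam : ℝ) : ((Fin n → ℂ) → ℂ) → L2 n :=
  Function.invFun (bargmann lam)

/-- The action `t · z = (e^{iα₁(t)} z₁, …, e^{iαₙ(t)} zₙ)` of `ℝᵐ` on `ℂⁿ`. -/
def act {m n : ℕ} (α : Fin n → Module.Dual ℝ (Fin m → ℝ)) (t : Fin m → ℝ) (z : Fin n → ℂ) :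
    Fin n → ℂ :=
  fun k => Complex.exp (Complex.I * (α k t : ℝ)) * z k

/-- The operator `(σ(t) f)(z) = χ(t) f(t⁻¹ · z)`. -/
def sigma {m n : ℕ} (α : Fin n → Module.Dual ℝ (Fin m → ℝ)) (χ : AddChar (Fin m → ℝ) Circle)
    (t : Fin m → ℝ) (f : (Fin n → ℂ) → ℂ) : (Fin n → ℂ) → ℂ :=
  fun z => (χ t : ℂ) * f (act α (-t) z)

/-- The Bargmann–Fock representation of the Heisenberg group:
`(ρ(z₀,c₀) f)(z) = exp(iλc₀ + (λ/2) z̄₀ z - (λ/4)|z₀|²) f(z - z₀)`. -/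
def rho {n : ℕ} (lam : ℝ) (z₀ : Fin n → ℂ) (c₀ : ℝ) (f : (Fin n → ℂ) → ℂ) : (Fin n → ℂ) → ℂ :=
  fun z => Complex.exp (Complex.I * lam * c₀ + (lam / 2) * ∑ k, starRingEnd ℂ (z₀ k) * z k
    - (lam / 4) * ∑ k, (‖z₀ k‖ : ℂ) ^ 2) * f (z - z₀)

/-- The operator `π(t, z₀, c₀) = ρ(z₀, c₀) σ(t)` of the generalized diamond group. -/
def diamondRep {m n : ℕ} (lam : ℝ) (α : Fin n → Module.Dual ℝ (Fin m → ℝ))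
    (χ : AddChar (Fin m → ℝ) Circle) (t : Fin m → ℝ) (z₀ : Fin n → ℂ) (c₀ : ℝ)
    (f : (Fin n → ℂ) → ℂ) : (Fin n → ℂ) → ℂ :=
  rho lam z₀ c₀ (sigma α χ t f)

/-- `σ'(t) = B⁻¹ σ(t) B` on `L²(ℝⁿ)`. -/
def sigma' {m n : ℕ} (lam : ℝ) (α : Fin n → Module.Dual ℝ (Fin m → ℝ))
    (χ : AddChar (Fin m → ℝ) Circle) (t : Fin m → ℝ) (φ : L2 n) : L2 n :=
  bargmannInv lam (sigma α χ t (bargmann lam φ))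

/-- `π'(g) = B⁻¹ π(g) B` on `L²(ℝⁿ)`. -/
def diamondRep' {m n : ℕ} (lam : ℝ) (α : Fin n → Module.Dual ℝ (Fin m → ℝ))
    (χ : AddChar (Fin m → ℝ) Circle) (t : Fin m → ℝ) (z₀ : Fin n → ℂ) (c₀ : ℝ) (φ : L2 n) : L2 n :=
  bargmannInv lam (diamondRep lam α χ t z₀ c₀ (bargmann lam φ))

/-- `K` is the integral kernel of the operator `T` on `L²(ℝⁿ)`: for `φ ∈ L¹ ∩ L²` the function `T φ`
is given almost everywhere by the absolutely convergent integral `∫ K(x,y) φ(y) dy`, and for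
every `φ ∈ L²` it is the `L²` limit of the integrals over the balls `|y| ≤ R` as `R → ∞`. -/
structure IsKernel {n : ℕ} (T : L2 n → L2 n)
    (K : EuclideanSpace ℝ (Fin n) → EuclideanSpace ℝ (Fin n) → ℂ) : Prop where
  measurable : Measurable (Function.uncurry K)
  integrable : ∀ φ : L2 n, Integrable φ volume →
    ∀ᵐ x, Integrable (fun y => K x y * φ y) volume
  apply_eq : ∀ φ : L2 n, Integrable φ volume →
    T φ =ᵐ[volume] fun x => ∫ y, K x y * φ y
  tendsto : ∀ φ : L2 n, Tendsto
    (fun R : ℝ => eLpNorm (fun x => T φ x - ∫ y in Metric.closedBall 0 R, K x y * φ y) 2 volume)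
    atTop (𝓝 0)

/-- The diagonal matrix `A(t) = Diag(e^{iα₁(t)}, …, e^{iαₙ(t)})`. -/
def actMatrix {m n : ℕ} (α : Fin n → Module.Dual ℝ (Fin m → ℝ)) (t : Fin m → ℝ) :
    Matrix (Fin n) (Fin n) ℂ :=
  Matrix.diagonal fun k => Complex.exp (Complex.I * (α k t : ℝ))

/-- The branch of `(det M)^{-1/2}` used for Gaussian integrals, for `M` with eigenvalues in
the right half-plane: the product, over the eigenvalues `μ` of `M` with multiplicity, of the
principal values of `μ^{-1/2}`. -/
def detInvSqrt {n : ℕ} (M : Matrix (Fin n) (Fin n) ℂ) : ℂ :=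
  (M.charpoly.roots.map fun μ => μ ^ (-(1 / 2) : ℂ)).prod

/-- The bilinear form `x M y` of a complex matrix `M` on real vectors. -/
def form {n : ℕ} (M : Matrix (Fin n) (Fin n) ℂ) (x y : EuclideanSpace ℝ (Fin n)) : ℂ :=
  (fun k => (x k : ℂ)) ⬝ᵥ M.mulVec (fun k => (y k : ℂ))

/-- The kernel `b_t(x,y)` in matrix form. -/
def mehlerMatrix {m n : ℕ} (lam : ℝ) (α : Fin n → Module.Dual ℝ (Fin m → ℝ))
    (χ : AddChar (Fin m → ℝ) Circle) (t : Fin m → ℝ) (x y : EuclideanSpace ℝ (Fin n)) : ℂ :=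
  (((lam / Real.pi) ^ ((n : ℝ) / 2) : ℝ) : ℂ) * (χ t : ℂ)
    * detInvSqrt (1 - actMatrix α (-t) ^ 2)
    * Complex.exp ((lam / 2) * (∑ k, (x k : ℂ) ^ 2 + ∑ k, (y k : ℂ) ^ 2))
    * Complex.exp (lam * (form (actMatrix α (-t) ^ 2 - 1)⁻¹ y y
        - 2 * form (actMatrix α (-t) * (actMatrix α (-t) ^ 2 - 1)⁻¹) x y
        + form (actMatrix α (-t) ^ 2 - 1)⁻¹ x x))

/-- The kernel `b_t(x,y)` in trigonometric form. -/
def mehler {m n : ℕ} (lam : ℝ) (α : Fin n → Module.Dual ℝ (Fin m → ℝ))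
    (χ : AddChar (Fin m → ℝ) Circle) (t : Fin m → ℝ) (x y : EuclideanSpace ℝ (Fin n)) : ℂ :=
  (((lam / Real.pi) ^ ((n : ℝ) / 2) : ℝ) : ℂ) * (χ t : ℂ)
    * (∏ k, (1 - Complex.exp (-2 * Complex.I * (α k t : ℝ))) ^ (-(1 / 2) : ℂ))
    * Complex.exp (
        Complex.I * (lam / 2) * ∑ k, ((Real.cos (α k t) / Real.sin (α k t)
          * (x k ^ 2 + y k ^ 2) : ℝ) : ℂ)
        - Complex.I * lam * ∑ k, (((Real.sin (α k t))⁻¹ * (x k * y k) : ℝ) : ℂ))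

end Diamond

end

open MeasureTheory Filter Topology

noncomputable section

namespace Diamond

variable {m n : ℕ}

theorem integrable_cexp_gaussian {b : Fin n → ℂ} (hb : ∀ k, 0 < (b k).re) (c : Fin n → ℂ) :
    Integrable fun x : EuclideanSpace ℝ (Fin n) =>
      Complex.exp (-∑ k, b k * (x k : ℂ) ^ 2 + ∑ k, c k * x k) := by
  rw [← (PiLp.volume_preserving_toLp (Fin n)).integrable_comp_emb
    (MeasurableEquiv.toLp 2 _).measurableEmbedding]
  exact GaussianFourier.integrable_cexp_neg_sum_mul_add hb c

theorem integral_cexp_gaussian {b : Fin n → ℂ} (hb : ∀ k, 0 < (b k).re) (c : Fin n → ℂ) :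
    ∫ x : EuclideanSpace ℝ (Fin n), Complex.exp (-∑ k, b k * (x k : ℂ) ^ 2 + ∑ k, c k * x k) =
      ∏ k, (Real.pi / b k) ^ (1 / 2 : ℂ) * Complex.exp (c k ^ 2 / (4 * b k)) := by
  rw [← (PiLp.volume_preserving_toLp (Fin n)).integral_comp
    (MeasurableEquiv.toLp 2 _).measurableEmbedding]
  exact GaussianFourier.integral_cexp_neg_sum_mul_add hb c

/-- The kernel of the Bargmann transform as a Gaussian in the real variable. -/
theorem bargmannKernel_eq (lam : ℝ) (z : Fin n → ℂ) (x : EuclideanSpace ℝ (Fin n)) :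
    bargmannKernel lam z x = (((lam / Real.pi) ^ ((n : ℝ) / 4) : ℝ) : ℂ) *
      Complex.exp (-(lam / 4) * ∑ k, z k ^ 2) *
      Complex.exp (-∑ k, (lam / 2 : ℂ) * (x k : ℂ) ^ 2 + ∑ k, (lam * z k) * x k) := by
  rw [bargmannKernel, mul_assoc, ← Complex.exp_add]
  simp only [Finset.mul_sum, mul_assoc]
  congr 2
  ring

theorem continuous_bargmannKernel (lam : ℝ) (z : Fin n → ℂ) :
    Continuous (bargmannKernel (n := n) lam z) := by
  unfold bargmannKernel
  fun_prop

theorem integrable_bargmannKernel {lam : ℝ} (hlam : 0 < lam) (z : Fin n → ℂ) :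
    Integrable (bargmannKernel (n := n) lam z) := by
  simp only [funext (bargmannKernel_eq lam z)]
  refine (integrable_cexp_gaussian (fun _ => ?_) _).const_mul _
  rw [show (lam / 2 : ℂ) = ((lam / 2 : ℝ) : ℂ) by push_cast; rfl, Complex.ofReal_re]
  positivity

/-- A product of two kernels of Bargmann transforms is a Gaussian. -/
theorem bargmannKernel_mul_bargmannKernel (lam : ℝ) (z w : Fin n → ℂ)
    (x : EuclideanSpace ℝ (Fin n)) :
    bargmannKernel lam z x * bargmannKernel lam w x =
      (((lam / Real.pi) ^ ((n : ℝ) / 4) : ℝ) : ℂ) ^ 2 *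
      Complex.exp (-(lam / 4) * (∑ k, z k ^ 2 + ∑ k, w k ^ 2)) *
      Complex.exp (-∑ k, (lam : ℂ) * (x k : ℂ) ^ 2 + ∑ k, (lam * (z k + w k)) * x k) := by
  simp only [bargmannKernel_eq]
  rw [show ∀ a b c d e f : ℂ, a * b * c * (d * e * f) = (a * d) * (b * e) * (c * f) by
    intros; ring, ← Complex.exp_add, ← Complex.exp_add, ← sq]
  congr 2
  · ring_nf
  · simp only [← Finset.mul_sum, mul_add, add_mul, Finset.sum_add_distrib]
    ring

theorem integrable_bargmannKernel_mul {lam : ℝ} (hlam : 0 < lam) (z w : Fin n → ℂ) :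
    Integrable fun x : EuclideanSpace ℝ (Fin n) =>
      bargmannKernel lam z x * bargmannKernel lam w x := by
  simp only [bargmannKernel_mul_bargmannKernel]
  exact (integrable_cexp_gaussian (fun _ => by simpa using hlam) _).const_mul _

theorem memLp_bargmannKernel {lam : ℝ} (hlam : 0 < lam) (z : Fin n → ℂ) :
    MemLp (bargmannKernel (n := n) lam z) 2 volume := by
  rw [memLp_two_iff_integrable_sq_norm (continuous_bargmannKernel lam z).aestronglyMeasurable]
  refine (integrable_bargmannKernel_mul hlam z z).norm.congr (.of_forall fun x => ?_)
  simp [sq]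

theorem integral_bargmannKernel_mul {lam : ℝ} (hlam : 0 < lam) (z w : Fin n → ℂ) :
    ∫ x : EuclideanSpace ℝ (Fin n), bargmannKernel lam z x * bargmannKernel lam w x =
      Complex.exp ((lam / 2) * ∑ k, z k * w k) := by
  simp only [bargmannKernel_mul_bargmannKernel]
  rw [integral_const_mul, integral_cexp_gaussian (fun _ => by simpa using hlam),
    Finset.prod_mul_distrib, ← Complex.exp_sum, Finset.prod_const, Finset.card_univ,
    Fintype.card_fin]
  have hl : (lam : ℂ) ≠ 0 := by exact_mod_cast hlam.ne'
  have h1 : (((lam / Real.pi) ^ ((n : ℝ) / 4) : ℝ) : ℂ) ^ 2 *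
      ((Real.pi / lam : ℂ) ^ (1 / 2 : ℂ)) ^ n = 1 := by
    have hp := Real.pi_pos
    have h2 : (Real.pi / lam : ℂ) ^ (1 / 2 : ℂ) = (((Real.pi / lam) ^ (1 / 2 : ℝ) : ℝ) : ℂ) := by
      rw [Complex.ofReal_cpow (by positivity)]; push_cast; rfl
    rw [h2, ← Complex.ofReal_pow, ← Complex.ofReal_pow, ← Complex.ofReal_mul]
    norm_cast
    rw [← Real.rpow_natCast, ← Real.rpow_natCast, ← Real.rpow_mul (by positivity),
      ← Real.rpow_mul (by positivity), ← inv_div lam, Real.inv_rpow (by positivity)]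
    have : (n : ℝ) / 4 * ((2 : ℕ) : ℝ) = 1 / 2 * n := by push_cast; ring
    rw [this]
    exact mul_inv_cancel₀ (by positivity)
  rw [show ∀ a b c d : ℂ, a * b * (c * d) = (a * c) * (b * d) by intros; ring, h1, one_mul,
    ← Complex.exp_add]
  congr 1
  simp only [Finset.mul_sum, ← Finset.sum_add_distrib]
  refine Finset.sum_congr rfl fun k _ => ?_
  field_simp
  ring

theorem bargmannKernel_conj (lam : ℝ) (z : Fin n → ℂ) (x : EuclideanSpace ℝ (Fin n)) :
    starRingEnd ℂ (bargmannKernel lam z x) =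
      bargmannKernel lam (fun k => starRingEnd ℂ (z k)) x := by
  simp only [bargmannKernel, map_mul, Complex.conj_ofReal, ← Complex.exp_conj, map_add, map_sub,
    map_neg, map_div₀, map_sum, map_pow, map_ofNat]

/-- The coherent state `x ↦ conj B(w,x)`, which represents the evaluation at `w`. -/
def coherent {lam : ℝ} (hlam : 0 < lam) (w : Fin n → ℂ) : L2 n :=
  (memLp_bargmannKernel hlam (fun k => starRingEnd ℂ (w k))).toLp _

theorem coherent_coeFn {lam : ℝ} (hlam : 0 < lam) (w : Fin n → ℂ) :
    coherent hlam w =ᵐ[volume] bargmannKernel lam fun k => starRingEnd ℂ (w k) :=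
  MemLp.coeFn_toLp _

theorem bargmann_eq_inner {lam : ℝ} (hlam : 0 < lam) (φ : L2 n) (z : Fin n → ℂ) :
    bargmann lam φ z = inner ℂ (coherent hlam z) φ := by
  rw [L2.inner_def, bargmann]
  refine integral_congr_ae ?_
  filter_upwards [coherent_coeFn hlam z] with x hx
  rw [hx, RCLike.inner_apply, ← bargmannKernel_conj, starRingEnd_self_apply, mul_comm]

theorem bargmann_coherent {lam : ℝ} (hlam : 0 < lam) (w z : Fin n → ℂ) :
    bargmann lam (coherent hlam w) z =
      Complex.exp ((lam / 2) * ∑ k, z k * starRingEnd ℂ (w k)) := by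
  rw [← integral_bargmannKernel_mul hlam, bargmann]
  refine integral_congr_ae ?_
  filter_upwards [coherent_coeFn hlam w] with x hx
  rw [hx]

open scoped FourierTransform ContDiff in
/-- An integrable function whose Fourier transform vanishes is zero almost everywhere. -/
theorem ae_eq_zero_of_fourier_eq_zero {V : Type*} [NormedAddCommGroup V] [InnerProductSpace ℝ V]
    [FiniteDimensional ℝ V] [MeasurableSpace V] [BorelSpace V] {g : V → ℂ} (hg : Integrable g)
    (h : ∀ v, 𝓕 g v = 0) : g =ᵐ[volume] 0 := by
  refine ae_eq_zero_of_integral_contDiff_smul_eq_zero hg.locallyIntegrable fun s hs hsc => ?_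
  have hs₁ : HasCompactSupport (Complex.ofRealCLM ∘ s) := hsc.comp_left rfl
  have hs₂ : ContDiff ℝ ∞ (Complex.ofRealCLM ∘ s) := by fun_prop
  let S : SchwartzMap V ℂ := hs₁.toSchwartzMap hs₂
  have hS : (𝓕 (𝓕⁻ S : SchwartzMap V ℂ) : SchwartzMap V ℂ) = S := FourierTransform.fourier_fourierInv_eq S
  have key := VectorFourier.integral_fourierIntegral_smul_eq_flip (L := innerₗ V) (μ := volume)
    (ν := volume) Real.continuous_fourierChar continuous_inner (𝓕⁻ S).integrable hg
  have h1 : ∀ x, VectorFourier.fourierIntegral Real.fourierChar volume (innerₗ V)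
      ((𝓕⁻ S : SchwartzMap V ℂ) : V → ℂ) x = (s x : ℂ) := fun x => by
    change (𝓕 (𝓕⁻ S : SchwartzMap V ℂ) : SchwartzMap V ℂ) x = _
    rw [hS]
    rfl
  have h2 : ∀ x, VectorFourier.fourierIntegral Real.fourierChar volume (innerₗ V).flip g x = 0 :=
    fun x => by
    rw [flip_innerₗ]
    exact h x
  simp only [h1, h2, smul_zero, integral_zero] at key
  simpa using key

theorem bargmannKernel_eq_mul_zero (lam : ℝ) (z : Fin n → ℂ) (x : EuclideanSpace ℝ (Fin n)) :
    bargmannKernel lam z x = Complex.exp (-(lam / 4) * ∑ k, z k ^ 2) *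
      (Complex.exp (lam * ∑ k, z k * x k) * bargmannKernel lam 0 x) := by
  simp only [bargmannKernel, Pi.zero_apply]
  rw [mul_left_comm (Complex.exp (_ * ∑ k, z k * _)), mul_left_comm, ← Complex.exp_add,
    ← Complex.exp_add]
  congr 2
  simp
  ring

open scoped FourierTransform in
/-- The Bargmann transform is injective on the functions of at most Gaussian growth. -/
theorem ae_eq_zero_of_integral_bargmannKernel_eq_zero {lam : ℝ} (hlam : 0 < lam)
    {h : EuclideanSpace ℝ (Fin n) → ℂ}
    (hint : Integrable fun x => bargmannKernel lam 0 x * h x)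
    (hz : ∀ z, ∫ x, bargmannKernel lam z x * h x = 0) : h =ᵐ[volume] 0 := by
  have hl : (lam : ℂ) ≠ 0 := by exact_mod_cast hlam.ne'
  have key : (fun x => bargmannKernel lam 0 x * h x) =ᵐ[volume] 0 := by
    refine ae_eq_zero_of_fourier_eq_zero hint fun v => ?_
    rw [Real.fourier_eq']
    specialize hz fun k => -(2 * Real.pi / lam) * Complex.I * v k
    set z : Fin n → ℂ := fun k => -(2 * Real.pi / lam) * Complex.I * v k with hzdef
    have hz' : ∫ x, Complex.exp (-(lam / 4) * ∑ k, z k ^ 2) *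
        (Complex.exp (lam * ∑ k, z k * x k) * (bargmannKernel lam 0 x * h x)) = 0 := by
      rw [← hz]
      refine integral_congr_ae (.of_forall fun x => ?_)
      simp only [bargmannKernel_eq_mul_zero lam z x, mul_assoc]
    simp only [integral_const_mul, mul_eq_zero, Complex.exp_ne_zero, false_or] at hz'
    rw [← hz']
    refine integral_congr_ae (.of_forall fun x => ?_)
    simp only [smul_eq_mul]
    congr 2
    simp only [PiLp.inner_apply, RCLike.inner_apply, conj_trivial, Finset.mul_sum]
    push_cast
    rw [Finset.sum_mul]
    refine Finset.sum_congr rfl fun k _ => ?_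
    simp only [hzdef]
    field_simp
  filter_upwards [key] with x hx
  have : bargmannKernel lam 0 x ≠ 0 := by
    have := Real.pi_pos
    simp only [bargmannKernel, ne_eq, mul_eq_zero, Complex.exp_ne_zero, or_false]
    norm_cast
    positivity
  simpa [this] using hx

theorem integrable_bargmannKernel_mul_coeFn {lam : ℝ} (hlam : 0 < lam) (z : Fin n → ℂ)
    (φ : L2 n) : Integrable fun x => bargmannKernel lam z x * φ x :=
  (memLp_bargmannKernel hlam z).integrable_mul (Lp.memLp φ)

theorem norm_bargmannKernel (lam : ℝ) (hlam : 0 < lam) (z : Fin n → ℂ)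
    (x : EuclideanSpace ℝ (Fin n)) :
    ‖bargmannKernel lam z x‖ = (lam / Real.pi) ^ ((n : ℝ) / 4) *
      Real.exp (∑ k, (-(lam / 4) * (z k ^ 2).re + lam * ((z k).re * x k)
        - (lam / 2) * x k ^ 2)) := by
  have hp := Real.pi_pos
  rw [bargmannKernel, norm_mul, Complex.norm_exp, Complex.norm_real, Real.norm_of_nonneg
    (by positivity)]
  congr 2
  rw [show (-(lam / 4) * ∑ k, z k ^ 2 + lam * ∑ k, z k * x k - (lam / 2) * ∑ k, (x k : ℂ) ^ 2 : ℂ)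
    = ∑ k, (((-(lam / 4) : ℝ) : ℂ) * z k ^ 2 + (lam : ℂ) * (z k * (x k : ℂ))
      - ((lam / 2 * x k ^ 2 : ℝ) : ℂ)) by
    simp only [Finset.sum_sub_distrib, Finset.sum_add_distrib, Finset.mul_sum]
    push_cast
    rfl, Complex.re_sum]
  refine Finset.sum_congr rfl fun k _ => ?_
  rw [Complex.sub_re, Complex.add_re, Complex.re_ofReal_mul, Complex.re_ofReal_mul,
    Complex.re_mul_ofReal, Complex.ofReal_re]

/-- The logarithmic derivative of `z ↦ B(z,x)`. -/
def bargmannLogDeriv (lam : ℝ) (z : Fin n → ℂ) (x : EuclideanSpace ℝ (Fin n)) :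
    (Fin n → ℂ) →L[ℂ] ℂ :=
  ∑ k, (-(lam / 2) * z k + lam * x k : ℂ) • ContinuousLinearMap.proj (R := ℂ) k

theorem hasFDerivAt_bargmannKernel (lam : ℝ) (z : Fin n → ℂ) (x : EuclideanSpace ℝ (Fin n)) :
    HasFDerivAt (fun z => bargmannKernel lam z x)
      (bargmannKernel lam z x • bargmannLogDeriv lam z x) z := by
  have h : HasFDerivAt (fun z : Fin n → ℂ => -(lam / 4) * ∑ k, z k ^ 2 + lam * ∑ k, z k * x k
      - (lam / 2) * ∑ k, (x k : ℂ) ^ 2 : (Fin n → ℂ) → ℂ) (bargmannLogDeriv lam z x) z := by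
    have h1 : ∀ k : Fin n, HasFDerivAt (fun z : Fin n → ℂ => z k)
        (ContinuousLinearMap.proj (R := ℂ) (φ := fun _ : Fin n => ℂ) k) z :=
      fun k => hasFDerivAt_apply k z
    refine ((((HasFDerivAt.fun_sum (u := Finset.univ) fun k _ => (h1 k).pow 2).const_mul
      (-(lam / 4 : ℂ))).add ((HasFDerivAt.fun_sum (u := Finset.univ) fun k _ =>
        (h1 k).mul_const (x k : ℂ)).const_mul (lam : ℂ))).sub_const
        ((lam / 2) * ∑ k, (x k : ℂ) ^ 2)).congr_fderiv ?_
    simp only [bargmannLogDeriv, Finset.smul_sum, ← Finset.sum_add_distrib]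
    refine Finset.sum_congr rfl fun k _ => ?_
    ext v
    simp
    ring
  have := h.cexp.const_mul ((((lam / Real.pi) ^ ((n : ℝ) / 4) : ℝ) : ℂ))
  rw [smul_smul] at this
  exact this

theorem norm_bargmannLogDeriv_le {lam : ℝ} (hlam : 0 < lam) {z : Fin n → ℂ} {R : ℝ}
    (hz : ‖z‖ ≤ R) (x : EuclideanSpace ℝ (Fin n)) :
    ‖bargmannLogDeriv lam z x‖ ≤
      (n * (lam / 2 * R + lam) + 8) * Real.exp (lam / 8 * ∑ k, x k ^ 2) := by
  have hR : 0 ≤ R := (norm_nonneg z).trans hz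
  have h1 : ‖bargmannLogDeriv lam z x‖ ≤ ∑ k, (lam / 2 * R + lam + lam * x k ^ 2) := by
    refine (norm_sum_le _ _).trans (Finset.sum_le_sum fun k _ => ?_)
    rw [norm_smul]
    have hproj : ‖ContinuousLinearMap.proj (R := ℂ) (φ := fun _ : Fin n => ℂ) k‖ ≤ 1 :=
      ContinuousLinearMap.opNorm_le_bound _ zero_le_one fun v => by
        simpa using norm_le_pi_norm v k
    have hzk : ‖z k‖ ≤ R := (norm_le_pi_norm z k).trans hz
    have hx : |x k| ≤ 1 + x k ^ 2 := by
      rw [← sq_abs]; nlinarith [sq_nonneg (|x k| - 1)]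
    calc _ ≤ ‖(-(lam / 2) * z k + lam * x k : ℂ)‖ * 1 := by gcongr
      _ ≤ (‖(-(lam / 2) * z k : ℂ)‖ + ‖(lam * x k : ℂ)‖) := by
        rw [mul_one]; exact norm_add_le _ _
      _ = lam / 2 * ‖z k‖ + lam * |x k| := by
        simp [abs_of_pos hlam]
      _ ≤ lam / 2 * R + lam * (1 + x k ^ 2) := by gcongr
      _ = _ := by ring
  set S := ∑ k, x k ^ 2 with hS
  have hS0 : 0 ≤ S := Finset.sum_nonneg fun k _ => sq_nonneg _
  rw [Finset.sum_add_distrib, ← Finset.mul_sum, ← hS, Finset.sum_const, Finset.card_univ,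
    Fintype.card_fin, nsmul_eq_mul] at h1
  have h2 : 1 ≤ Real.exp (lam / 8 * S) := Real.one_le_exp (by positivity)
  have h3 : lam / 8 * S + 1 ≤ Real.exp (lam / 8 * S) := Real.add_one_le_exp _
  have h4 : (n : ℝ) * (lam / 2 * R + lam) ≤
      n * (lam / 2 * R + lam) * Real.exp (lam / 8 * S) :=
    le_mul_of_one_le_right (by positivity) h2
  linarith

theorem norm_bargmannKernel_le {lam : ℝ} (hlam : 0 < lam) {z : Fin n → ℂ} {R : ℝ}
    (hz : ‖z‖ ≤ R) (x : EuclideanSpace ℝ (Fin n)) :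
    ‖bargmannKernel lam z x‖ ≤ (lam / Real.pi) ^ ((n : ℝ) / 4) *
      Real.exp (n * (5 / 4 * lam * R ^ 2)) * Real.exp (-(lam / 4) * ∑ k, x k ^ 2) := by
  have hp := Real.pi_pos
  rw [norm_bargmannKernel _ hlam, mul_assoc, ← Real.exp_add]
  gcongr
  calc _ ≤ ∑ k : Fin n, (5 / 4 * lam * R ^ 2 + -(lam / 4) * x k ^ 2) := by
        refine Finset.sum_le_sum fun k _ => ?_
        have hzk : ‖z k‖ ≤ R := (norm_le_pi_norm z k).trans hz
        have h1 : -(R ^ 2) ≤ (z k ^ 2).re := by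
          have := (abs_le.1 (Complex.abs_re_le_norm (z k ^ 2))).1
          rw [norm_pow] at this
          nlinarith [norm_nonneg (z k)]
        have h2 : (z k).re ^ 2 ≤ R ^ 2 := by
          have := Complex.abs_re_le_norm (z k)
          exact sq_le_sq' (by linarith [(abs_le.1 this).1]) (by linarith [(abs_le.1 this).2])
        have h3 : (z k).re * x k ≤ (z k).re ^ 2 + x k ^ 2 / 4 := by
          nlinarith [sq_nonneg ((z k).re - x k / 2)]
        nlinarith
    _ = _ := by
        rw [Finset.sum_add_distrib, Finset.mul_sum, Finset.sum_const, Finset.card_univ,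
          Fintype.card_fin, nsmul_eq_mul]

theorem differentiable_bargmann {lam : ℝ} (hlam : 0 < lam) (φ : L2 n) :
    Differentiable ℂ (bargmann lam φ) := by
  intro z₀
  have hp := Real.pi_pos
  set R := ‖z₀‖ + 1 with hR
  obtain ⟨C, hC⟩ : ∃ C : ℝ, ∀ z : Fin n → ℂ, ‖z‖ ≤ R → ∀ x,
      ‖bargmannKernel lam z x‖ * ‖bargmannLogDeriv lam z x‖ ≤
        C * ‖bargmannKernel (n := n) (lam / 4) 0 x‖ := by
    have hc : 0 < (lam / 4 / Real.pi) ^ ((n : ℝ) / 4) := by positivity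
    refine ⟨(lam / Real.pi) ^ ((n : ℝ) / 4) * Real.exp (n * (5 / 4 * lam * R ^ 2)) *
      (n * (lam / 2 * R + lam) + 8) / (lam / 4 / Real.pi) ^ ((n : ℝ) / 4), fun z hz x => ?_⟩
    refine (mul_le_mul (norm_bargmannKernel_le hlam hz x) (norm_bargmannLogDeriv_le hlam hz x)
      (norm_nonneg _) (by positivity)).trans_eq ?_
    rw [norm_bargmannKernel _ (by positivity)]
    simp only [Pi.zero_apply, ne_eq, OfNat.ofNat_ne_zero, not_false_eq_true, zero_pow,
      Complex.zero_re, mul_zero, zero_mul, zero_add, zero_sub, Finset.sum_neg_distrib,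
      ← Finset.mul_sum]
    rw [show ∀ a b c d e : ℝ, a * b * c * (d * e) = a * b * d * (c * e) by intros; ring,
      ← Real.exp_add, ← mul_assoc (_ / _), div_mul_cancel₀ _ hc.ne']
    congr 2
    ring
  refine (hasFDerivAt_integral_of_dominated_of_fderiv_le (𝕜 := ℂ) (s := Metric.ball z₀ 1)
    (F := fun z x => bargmannKernel lam z x * φ x)
    (F' := fun z x => φ x • (bargmannKernel lam z x • bargmannLogDeriv lam z x))
    (bound := fun x => C * (‖bargmannKernel (n := n) (lam / 4) 0 x‖ * ‖φ x‖))
    (Metric.ball_mem_nhds _ one_pos) (.of_forall fun z =>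
      (integrable_bargmannKernel_mul_coeFn hlam z φ).aestronglyMeasurable)
    (integrable_bargmannKernel_mul_coeFn hlam z₀ φ) ?_ ?_ ?_ ?_).differentiableAt
  · refine (Lp.aestronglyMeasurable φ).smul (Continuous.aestronglyMeasurable ?_)
    refine (continuous_bargmannKernel lam z₀).smul ?_
    unfold bargmannLogDeriv
    fun_prop
  · refine .of_forall fun x z hz => ?_
    have hz' : ‖z‖ ≤ R := by
      have := norm_le_norm_add_norm_sub' z z₀
      rw [Metric.mem_ball, dist_eq_norm] at hz
      linarith
    rw [norm_smul, norm_smul, mul_comm, ← mul_assoc]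
    exact mul_le_mul_of_nonneg_right (hC z hz' x) (norm_nonneg _)
  · exact ((memLp_bargmannKernel (by positivity) 0).norm.integrable_mul
      (Lp.memLp φ).norm).const_mul C
  · exact .of_forall fun x z _ => (hasFDerivAt_bargmannKernel lam z x).mul_const _

/-- The density of `fockMeasure` with respect to Lebesgue measure. -/
def fockWeight (n : ℕ) (lam : ℝ) (z : Fin n → ℂ) : ℝ :=
  (lam / (2 * Real.pi)) ^ n * Real.exp (-(lam / 2) * ∑ k, ‖z k‖ ^ 2)

theorem fockMeasure_eq (n : ℕ) (lam : ℝ) : fockMeasure n lam =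
    (volume : Measure (Fin n → ℂ)).withDensity fun z => ENNReal.ofReal (fockWeight n lam z) := rfl

theorem continuous_fockWeight (n : ℕ) (lam : ℝ) : Continuous (fockWeight n lam) := by
  unfold fockWeight
  fun_prop

theorem fockWeight_pos (n : ℕ) {lam : ℝ} (hlam : 0 < lam) (z : Fin n → ℂ) :
    0 < fockWeight n lam z := by
  have := Real.pi_pos
  unfold fockWeight
  positivity

theorem integral_fockMeasure {lam : ℝ} (hlam : 0 < lam) (f : (Fin n → ℂ) → ℂ) :
    ∫ z, f z ∂(fockMeasure n lam) = ∫ z, (fockWeight n lam z : ℂ) * f z := by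
  rw [fockMeasure_eq, integral_withDensity_eq_integral_toReal_smul
    (continuous_fockWeight n lam).measurable.ennreal_ofReal (.of_forall fun _ => by simp)]
  simp only [ENNReal.toReal_ofReal (fockWeight_pos n hlam _).le, Complex.real_smul]

theorem lintegral_fockMeasure (lam : ℝ) {f : (Fin n → ℂ) → ENNReal} (hf : Measurable f) :
    ∫⁻ z, f z ∂(fockMeasure n lam) = ∫⁻ z, ENNReal.ofReal (fockWeight n lam z) * f z := by
  rw [fockMeasure_eq, lintegral_withDensity_eq_lintegral_mul _
    (continuous_fockWeight n lam).measurable.ennreal_ofReal hf]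
  rfl

theorem integral_fockWeight {lam : ℝ} (hlam : 0 < lam) : ∫ z, fockWeight n lam z = 1 := by
  have hp := Real.pi_pos
  have h1 : ∫ z : ℂ, Real.exp (-(lam / 2) * ‖z‖ ^ 2) = 2 * Real.pi / lam := by
    have := GaussianFourier.integral_rexp_neg_mul_sq_norm (V := ℂ) (b := lam / 2) (by positivity)
    rw [Complex.finrank_real_complex] at this
    rw [this]
    norm_num
    field_simp
  simp only [fockWeight, Finset.mul_sum, Real.exp_sum, integral_const_mul]
  rw [integral_fintype_prod_volume_eq_prod (f := fun (_ : Fin n) (z : ℂ) =>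
    Real.exp (-(lam / 2) * ‖z‖ ^ 2)), Finset.prod_const, h1, Finset.card_univ, Fintype.card_fin,
    ← mul_pow]
  field_simp
  simp

theorem isProbabilityMeasure_fockMeasure (n : ℕ) {lam : ℝ} (hlam : 0 < lam) :
    IsProbabilityMeasure (fockMeasure n lam) := by
  refine ⟨?_⟩
  have hint : Integrable (fockWeight n lam) :=
    .of_integral_ne_zero (by rw [integral_fockWeight hlam]; exact one_ne_zero)
  rw [fockMeasure_eq, withDensity_apply _ MeasurableSet.univ, Measure.restrict_univ,
    ← ofReal_integral_eq_lintegral_ofReal hint (.of_forall fun z => (fockWeight_pos n hlam z).le),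
    integral_fockWeight hlam, ENNReal.ofReal_one]

/-- The rotations of the coordinates preserve the measure of the Fock space. -/
theorem measurePreserving_rotate (lam : ℝ) {u : Fin n → ℂ} (hu : ∀ k, ‖u k‖ = 1) :
    MeasurePreserving (fun z k => u k * z k) (fockMeasure n lam) (fockMeasure n lam) := by
  have hvol : MeasurePreserving (fun (z : Fin n → ℂ) k => u k * z k) volume volume := by
    refine volume_preserving_pi fun k => ?_
    have := (rotation (⟨u k, by simp [Submonoid.unitSphere, hu k]⟩ : Circle)).measurePreserving
    exact this
  refine ⟨hvol.measurable, ?_⟩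
  ext s hs
  rw [Measure.map_apply hvol.measurable hs, fockMeasure_eq, withDensity_apply _ hs,
    withDensity_apply _ (hvol.measurable hs), ← hvol.setLIntegral_comp_preimage hs
      (continuous_fockWeight n lam).measurable.ennreal_ofReal]
  simp [fockWeight, hu]

theorem eLpNorm_two_eq_of_lintegral {α β : Type*} [MeasurableSpace α] [MeasurableSpace β]
    {μ : Measure α} {ν : Measure β} {f : α → ℂ} {g : β → ℂ}
    (h : ∫⁻ x, ‖f x‖ₑ ^ 2 ∂μ = ∫⁻ x, ‖g x‖ₑ ^ 2 ∂ν) : eLpNorm f 2 μ = eLpNorm g 2 ν := by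
  rw [eLpNorm_eq_lintegral_rpow_enorm_toReal two_ne_zero ENNReal.ofNat_ne_top,
    eLpNorm_eq_lintegral_rpow_enorm_toReal two_ne_zero ENNReal.ofNat_ne_top]
  simp only [ENNReal.toReal_ofNat, ENNReal.rpow_ofNat, h]

theorem norm_sub_sq_eq (z w : ℂ) :
    ‖z - w‖ ^ 2 = ‖z‖ ^ 2 + ‖w‖ ^ 2 - 2 * (starRingEnd ℂ w * z).re := by
  rw [Complex.sq_norm, Complex.sq_norm, Complex.sq_norm, Complex.normSq_sub,
    mul_comm (starRingEnd ℂ w)]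

theorem eLpNorm_rho (lam : ℝ) (z₀ : Fin n → ℂ) (c₀ : ℝ) {f : (Fin n → ℂ) → ℂ}
    (hf : Continuous f) :
    eLpNorm (rho lam z₀ c₀ f) 2 (fockMeasure n lam) = eLpNorm f 2 (fockMeasure n lam) := by
  have hrho : Continuous (rho lam z₀ c₀ f) := by
    unfold rho
    fun_prop
  refine eLpNorm_two_eq_of_lintegral ?_
  rw [lintegral_fockMeasure _ (hrho.measurable.enorm.pow_const 2),
    lintegral_fockMeasure _ (hf.measurable.enorm.pow_const 2),
    ← lintegral_sub_right_eq_self (fun z => ENNReal.ofReal (fockWeight n lam z) * ‖f z‖ₑ ^ 2) z₀]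
  refine lintegral_congr fun z => ?_
  rw [rho, enorm_mul, mul_pow, ← mul_assoc]
  congr 1
  rw [← ofReal_norm, Complex.norm_exp, ← ENNReal.ofReal_pow (Real.exp_pos _).le,
    ← ENNReal.ofReal_mul' (by positivity), fockWeight, fockWeight, mul_assoc, ← Real.exp_nat_mul,
    ← Real.exp_add]
  congr 3
  have h : (Complex.I * lam * c₀ + (lam / 2) * ∑ k, starRingEnd ℂ (z₀ k) * z k
      - (lam / 4) * ∑ k, (‖z₀ k‖ : ℂ) ^ 2).re =
      lam / 2 * ∑ k, (starRingEnd ℂ (z₀ k) * z k).re - lam / 4 * ∑ k, ‖z₀ k‖ ^ 2 := by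
    rw [← Complex.re_sum]
    have e1 : (lam / 4 : ℂ) * ∑ k, (‖z₀ k‖ : ℂ) ^ 2 = ((lam / 4 * ∑ k, ‖z₀ k‖ ^ 2 : ℝ) : ℂ) := by
      push_cast; rfl
    have e2 : (lam / 2 : ℂ) = ((lam / 2 : ℝ) : ℂ) := by push_cast; rfl
    rw [e1, e2, Complex.sub_re, Complex.add_re, Complex.re_ofReal_mul, Complex.ofReal_re]
    simp
  rw [h]
  simp only [Pi.sub_apply, norm_sub_sq_eq, Finset.sum_sub_distrib, Finset.sum_add_distrib,
    ← Finset.mul_sum]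
  push_cast
  ring

theorem differentiable_rho (lam : ℝ) (z₀ : Fin n → ℂ) (c₀ : ℝ) {f : (Fin n → ℂ) → ℂ}
    (hf : Differentiable ℂ f) : Differentiable ℂ (rho lam z₀ c₀ f) := by
  unfold rho
  fun_prop

theorem rho_mem_fockSpace {lam : ℝ} (z₀ : Fin n → ℂ) (c₀ : ℝ) {f : (Fin n → ℂ) → ℂ}
    (hf : f ∈ fockSpace n lam) : rho lam z₀ c₀ f ∈ fockSpace n lam := by
  have hd := differentiable_rho lam z₀ c₀ hf.1
  refine ⟨hd, hd.continuous.aestronglyMeasurable, ?_⟩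
  rw [eLpNorm_rho lam z₀ c₀ hf.1.continuous]
  exact hf.2.2

theorem norm_exp_I_mul (r : ℝ) : ‖Complex.exp (Complex.I * r)‖ = 1 := by
  rw [mul_comm, Complex.norm_exp_ofReal_mul_I]

theorem differentiable_sigma (α : Fin n → Module.Dual ℝ (Fin m → ℝ))
    (χ : AddChar (Fin m → ℝ) Circle) (t : Fin m → ℝ) {f : (Fin n → ℂ) → ℂ}
    (hf : Differentiable ℂ f) : Differentiable ℂ (sigma α χ t f) := by
  have : Differentiable ℂ (act α (-t)) := by
    unfold act
    fun_prop
  exact (hf.comp this).const_mul _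

theorem eLpNorm_sigma (lam : ℝ) (α : Fin n → Module.Dual ℝ (Fin m → ℝ))
    (χ : AddChar (Fin m → ℝ) Circle) (t : Fin m → ℝ) {f : (Fin n → ℂ) → ℂ} (hf : Continuous f) :
    eLpNorm (sigma α χ t f) 2 (fockMeasure n lam) = eLpNorm f 2 (fockMeasure n lam) := by
  have h1 : eLpNorm (sigma α χ t f) 2 (fockMeasure n lam) =
      eLpNorm (f ∘ act α (-t)) 2 (fockMeasure n lam) :=
    eLpNorm_congr_norm_ae (.of_forall fun z => by
      rw [sigma, norm_mul, Circle.norm_coe, one_mul, Function.comp_apply])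
  rw [h1]
  exact eLpNorm_comp_measurePreserving hf.aestronglyMeasurable
    (measurePreserving_rotate lam fun k => norm_exp_I_mul _)

theorem sigma_mem_fockSpace {lam : ℝ} (α : Fin n → Module.Dual ℝ (Fin m → ℝ))
    (χ : AddChar (Fin m → ℝ) Circle) (t : Fin m → ℝ) {f : (Fin n → ℂ) → ℂ}
    (hf : f ∈ fockSpace n lam) : sigma α χ t f ∈ fockSpace n lam := by
  have hd := differentiable_sigma α χ t hf.1
  refine ⟨hd, hd.continuous.aestronglyMeasurable, ?_⟩
  rw [eLpNorm_sigma lam α χ t hf.1.continuous]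
  exact hf.2.2

/-- The mean value property of the functions in the Fock space. -/
theorem integral_fockMeasure_eq_apply_zero {lam : ℝ} (hlam : 0 < lam) {f : (Fin n → ℂ) → ℂ}
    (hf : f ∈ fockSpace n lam) : ∫ z, f z ∂(fockMeasure n lam) = f 0 := by
  have := isProbabilityMeasure_fockMeasure n hlam
  have hint : Integrable f (fockMeasure n lam) := hf.2.integrable one_le_two
  have hrot : ∀ θ : ℝ, MeasurePreserving (fun z : Fin n → ℂ => circleMap 0 1 θ • z)
      (fockMeasure n lam) (fockMeasure n lam) := fun θ =>
    measurePreserving_rotate lam (u := fun _ => circleMap 0 1 θ) fun _ => by simp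
  have hcont : Continuous fun p : ℝ × (Fin n → ℂ) => f (circleMap 0 1 p.1 • p.2) :=
    hf.1.continuous.comp (((continuous_circleMap 0 1).comp continuous_fst).smul continuous_snd)
  have hprod : Integrable (fun p : ℝ × (Fin n → ℂ) => f (circleMap 0 1 p.1 • p.2))
      ((volume.restrict (Set.Ioc 0 (2 * Real.pi))).prod (fockMeasure n lam)) := by
    rw [integrable_prod_iff hcont.aestronglyMeasurable]
    refine ⟨.of_forall fun θ => (hrot θ).integrable_comp_of_integrable hint, ?_⟩
    have : ∀ θ : ℝ, ∫ z, ‖f (circleMap 0 1 θ • z)‖ ∂(fockMeasure n lam) =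
        ∫ z, ‖f z‖ ∂(fockMeasure n lam) := fun θ => by
      conv_rhs => rw [← (hrot θ).map_eq, integral_map (hrot θ).aemeasurable
        hf.1.continuous.norm.aestronglyMeasurable]
    simp only [this]
    exact integrable_const _
  have hθ : ∀ θ : ℝ, ∫ z, f (circleMap 0 1 θ • z) ∂(fockMeasure n lam) =
      ∫ z, f z ∂(fockMeasure n lam) := fun θ => by
    conv_rhs => rw [← (hrot θ).map_eq, integral_map (hrot θ).aemeasurable
      hf.1.continuous.aestronglyMeasurable]
  have hmean : ∀ z : Fin n → ℂ,
      ∫ θ in Set.Ioc 0 (2 * Real.pi), f (circleMap 0 1 θ • z) = (2 * Real.pi) • f 0 := fun z => by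
    have hd : Differentiable ℂ fun ζ : ℂ => f (ζ • z) :=
      hf.1.comp (differentiable_id.smul_const z)
    have := (hd.diffContOnCl (s := Metric.ball 0 |1|)).circleAverage
    rw [Real.circleAverage_def, intervalIntegral.integral_of_le Real.two_pi_pos.le] at this
    simp only [zero_smul] at this
    rw [← this, smul_inv_smul₀ Real.two_pi_pos.ne']
  have hswap := integral_integral_swap (f := fun θ z => f (circleMap 0 1 θ • z)) hprod
  simp only [hθ, hmean, integral_const, probReal_univ, one_smul] at hswap
  rw [measureReal_restrict_apply_univ, Real.volume_real_Ioc_of_le Real.two_pi_pos.le,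
    sub_zero] at hswap
  exact smul_right_injective _ Real.two_pi_pos.ne' hswap

/-- The reproducing kernel `k_w(z) = exp((λ/2) z w̄)` of the Fock space. -/
def fockKernel (lam : ℝ) (w z : Fin n → ℂ) : ℂ :=
  Complex.exp ((lam / 2) * ∑ k, z k * starRingEnd ℂ (w k))

theorem one_mem_fockSpace (n : ℕ) {lam : ℝ} (hlam : 0 < lam) :
    (fun _ => 1 : (Fin n → ℂ) → ℂ) ∈ fockSpace n lam := by
  have := isProbabilityMeasure_fockMeasure n hlam
  exact ⟨differentiable_const _, memLp_const _⟩

theorem fockKernel_mem_fockSpace {lam : ℝ} (hlam : 0 < lam) (w : Fin n → ℂ) :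
    fockKernel lam w ∈ fockSpace n lam := by
  have h := (fockSpace n lam).smul_mem (Complex.exp ((lam / 4) * ∑ k, (‖w k‖ : ℂ) ^ 2))
    (rho_mem_fockSpace w 0 (one_mem_fockSpace n hlam))
  convert! h using 1
  ext z
  rw [Pi.smul_apply, rho, mul_one, smul_eq_mul, ← Complex.exp_add, fockKernel]
  congr 1
  simp only [mul_comm (z _)]
  push_cast
  ring

/-- The reproducing property of the Fock space. -/
theorem fockInner_fockKernel {lam : ℝ} (hlam : 0 < lam) {f : (Fin n → ℂ) → ℂ}
    (hf : f ∈ fockSpace n lam) (w : Fin n → ℂ) : fockInner n lam f (fockKernel lam w) = f w := by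
  have h := integral_fockMeasure_eq_apply_zero hlam (rho_mem_fockSpace (-w) 0 hf)
  set c : ℂ := Complex.exp (-(lam / 4) * ∑ k, (‖w k‖ : ℂ) ^ 2) with hc
  have h0 : rho lam (-w) 0 f 0 = c * f w := by
    simp [rho, hc]
  rw [h0, integral_fockMeasure hlam] at h
  refine mul_left_cancel₀ (Complex.exp_ne_zero _ : c ≠ 0) (Eq.trans ?_ h)
  rw [fockInner, integral_fockMeasure hlam, ← integral_const_mul,
    ← integral_add_right_eq_self _ w]
  refine integral_congr_ae (.of_forall fun z => ?_)
  simp only [rho, sub_neg_eq_add]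
  rw [show ∀ a b d e : ℂ, a * (b * (d * e)) = (b * (a * e)) * d by intros; ring,
    ← mul_assoc (fockWeight n lam z : ℂ)]
  congr 1
  rw [fockKernel, ← Complex.exp_conj, ← Complex.exp_add, fockWeight, fockWeight]
  push_cast
  rw [mul_assoc, mul_assoc, ← Complex.exp_add, ← Complex.exp_add]
  congr 2
  simp only [map_mul, map_div₀, Complex.conj_ofReal, map_ofNat, map_sum, map_add, Pi.add_apply,
    starRingEnd_self_apply, ← Complex.conj_mul', Pi.neg_apply, map_neg, norm_neg, Finset.mul_sum,
    mul_zero, zero_add, ← Finset.sum_add_distrib, ← Finset.sum_sub_distrib]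
  refine Finset.sum_congr rfl fun k _ => ?_
  ring

theorem bargmann_add {lam : ℝ} (hlam : 0 < lam) (φ ψ : L2 n) :
    bargmann lam (φ + ψ) = bargmann lam φ + bargmann lam ψ := by
  ext z
  simp only [bargmann_eq_inner hlam, Pi.add_apply, inner_add_right]

theorem bargmann_sub {lam : ℝ} (hlam : 0 < lam) (φ ψ : L2 n) :
    bargmann lam (φ - ψ) = bargmann lam φ - bargmann lam ψ := by
  ext z
  simp only [bargmann_eq_inner hlam, Pi.sub_apply, inner_sub_right]

theorem bargmann_smul {lam : ℝ} (hlam : 0 < lam) (c : ℂ) (φ : L2 n) :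
    bargmann lam (c • φ) = c • bargmann lam φ := by
  ext z
  simp only [bargmann_eq_inner hlam, Pi.smul_apply, inner_smul_right, smul_eq_mul]

theorem bargmann_injective {lam : ℝ} (hlam : 0 < lam) :
    Function.Injective (bargmann (n := n) lam) := by
  intro φ ψ h
  rw [← sub_eq_zero, Lp.eq_zero_iff_ae_eq_zero]
  refine ae_eq_zero_of_integral_bargmannKernel_eq_zero hlam
    (integrable_bargmannKernel_mul_coeFn hlam 0 _) fun z => ?_
  have : bargmann lam (φ - ψ) z = 0 := by rw [bargmann_sub hlam, h, sub_self, Pi.zero_apply]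
  exact this

/-- The coherent states are total in `L²(ℝⁿ)`. -/
theorem dense_span_coherent {lam : ℝ} (hlam : 0 < lam) :
    Dense (Submodule.span ℂ (Set.range (coherent (n := n) hlam)) : Set (L2 n)) := by
  rw [Submodule.dense_iff_topologicalClosure_eq_top, Submodule.topologicalClosure_eq_top_iff,
    Submodule.eq_bot_iff]
  intro φ hφ
  refine bargmann_injective hlam ?_
  ext z
  rw [bargmann_eq_inner hlam, bargmann_eq_inner hlam, inner_zero_right]
  exact hφ _ (Submodule.subset_span ⟨z, rfl⟩)

theorem fockInner_eq_inner {lam : ℝ} {f g : (Fin n → ℂ) → ℂ} (hf : MemLp f 2 (fockMeasure n lam))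
    (hg : MemLp g 2 (fockMeasure n lam)) :
    fockInner n lam f g = inner ℂ (hg.toLp g) (hf.toLp f) := by
  rw [L2.inner_def, fockInner]
  refine integral_congr_ae ?_
  filter_upwards [hf.coeFn_toLp, hg.coeFn_toLp] with z h1 h2
  rw [h1, h2, RCLike.inner_apply]

theorem bargmann_coherent_eq {lam : ℝ} (hlam : 0 < lam) (w : Fin n → ℂ) :
    bargmann lam (coherent hlam w) = fockKernel lam w :=
  funext fun z => bargmann_coherent hlam w z

theorem bargmann_mem_of_mem_span {lam : ℝ} (hlam : 0 < lam) {ψ : L2 n}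
    (hψ : ψ ∈ Submodule.span ℂ (Set.range (coherent hlam))) :
    bargmann lam ψ ∈ fockSpace n lam := by
  induction hψ using Submodule.span_induction with
  | mem ψ h =>
    obtain ⟨w, rfl⟩ := h
    rw [bargmann_coherent_eq]
    exact fockKernel_mem_fockSpace hlam w
  | zero =>
    convert! (fockSpace n lam).zero_mem using 1
    ext z
    rw [bargmann_eq_inner hlam, inner_zero_right, Pi.zero_apply]
  | add ψ₁ ψ₂ _ _ h₁ h₂ =>
    rw [bargmann_add hlam]
    exact (fockSpace n lam).add_mem h₁ h₂
  | smul c ψ _ h =>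
    rw [bargmann_smul hlam]
    exact (fockSpace n lam).smul_mem c h

theorem fockInner_bargmann_of_mem_span {lam : ℝ} (hlam : 0 < lam) {φ ψ : L2 n}
    (hφ : bargmann lam φ ∈ fockSpace n lam)
    (hψ : ψ ∈ Submodule.span ℂ (Set.range (coherent hlam))) :
    fockInner n lam (bargmann lam φ) (bargmann lam ψ) = inner ℂ ψ φ := by
  induction hψ using Submodule.span_induction with
  | mem ψ h =>
    obtain ⟨w, rfl⟩ := h
    rw [bargmann_coherent_eq, fockInner_fockKernel hlam hφ, bargmann_eq_inner hlam]
  | zero =>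
    have : bargmann lam (0 : L2 n) = 0 := by
      ext z
      rw [bargmann_eq_inner hlam, inner_zero_right, Pi.zero_apply]
    simp [this, fockInner]
  | add ψ₁ ψ₂ m₁ m₂ h₁ h₂ =>
    have k₁ := (bargmann_mem_of_mem_span hlam m₁).2
    have k₂ := (bargmann_mem_of_mem_span hlam m₂).2
    rw [fockInner_eq_inner hφ.2 k₁] at h₁
    rw [fockInner_eq_inner hφ.2 k₂] at h₂
    rw [bargmann_add hlam, fockInner_eq_inner hφ.2 (k₁.add k₂), MemLp.toLp_add k₁ k₂, inner_add_left,
      h₁, h₂, inner_add_left]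
  | smul c ψ m₁ h =>
    have k := (bargmann_mem_of_mem_span hlam m₁).2
    rw [fockInner_eq_inner hφ.2 k] at h
    rw [bargmann_smul hlam, fockInner_eq_inner hφ.2 (k.const_smul c), MemLp.toLp_const_smul c k,
      inner_smul_left, h, inner_smul_left]

theorem eLpNorm_bargmann_of_mem_span {lam : ℝ} (hlam : 0 < lam) {ψ : L2 n}
    (hψ : ψ ∈ Submodule.span ℂ (Set.range (coherent hlam))) :
    eLpNorm (bargmann lam ψ) 2 (fockMeasure n lam) = ENNReal.ofReal ‖ψ‖ := by
  have hm := bargmann_mem_of_mem_span hlam hψ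
  have h := fockInner_bargmann_of_mem_span hlam hm hψ
  rw [fockInner_eq_inner hm.2 hm.2, inner_self_eq_norm_sq_to_K, inner_self_eq_norm_sq_to_K] at h
  have h2 : ‖hm.2.toLp (bargmann lam ψ)‖ = ‖ψ‖ := by
    refine (sq_eq_sq₀ (norm_nonneg _) (norm_nonneg _)).1 ?_
    exact_mod_cast h
  rw [← h2, Lp.norm_toLp, ENNReal.ofReal_toReal hm.2.2.ne]

theorem eLpNorm_bargmann_le {lam : ℝ} (hlam : 0 < lam) (φ : L2 n) :
    eLpNorm (bargmann lam φ) 2 (fockMeasure n lam) ≤ ENNReal.ofReal ‖φ‖ := by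
  obtain ⟨u, hu, hlim⟩ := mem_closure_iff_seq_limit.1 (dense_span_coherent hlam φ)
  refine (Lp.eLpNorm_lim_le_liminf_eLpNorm (f := fun j => bargmann lam (u j))
    (fun j => (differentiable_bargmann hlam _).continuous.aestronglyMeasurable) _
    (.of_forall fun z => ?_)).trans_eq ?_
  · simp only [bargmann_eq_inner hlam]
    exact tendsto_const_nhds.inner hlim
  · simp only [fun j => eLpNorm_bargmann_of_mem_span hlam (hu j)]
    exact (ENNReal.tendsto_ofReal hlim.norm).liminf_eq

theorem bargmann_mem_fockSpace {lam : ℝ} (hlam : 0 < lam) (φ : L2 n) :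
    bargmann lam φ ∈ fockSpace n lam :=
  ⟨differentiable_bargmann hlam φ,
    (differentiable_bargmann hlam φ).continuous.aestronglyMeasurable,
    (eLpNorm_bargmann_le hlam φ).trans_lt ENNReal.ofReal_lt_top⟩

/-- The Bargmann transform as a bounded operator into `L²(ℂⁿ, fockMeasure)`. -/
def bargmannL {lam : ℝ} (hlam : 0 < lam) : L2 n →L[ℂ] Lp ℂ 2 (fockMeasure n lam) :=
  LinearMap.mkContinuous
    { toFun := fun φ => (bargmann_mem_fockSpace hlam φ).2.toLp _
      map_add' := fun φ ψ => by
        rw [← MemLp.toLp_add]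
        exact MemLp.toLp_congr _ _ (.of_forall fun z => by rw [bargmann_add hlam])
      map_smul' := fun c φ => by
        rw [RingHom.id_apply, ← MemLp.toLp_const_smul]
        exact MemLp.toLp_congr _ _ (.of_forall fun z => by rw [bargmann_smul hlam]) }
    1 fun φ => by
      rw [LinearMap.coe_mk, AddHom.coe_mk, Lp.norm_toLp, one_mul]
      exact ENNReal.toReal_le_of_le_ofReal (norm_nonneg _) (eLpNorm_bargmann_le hlam φ)

theorem bargmannL_apply {lam : ℝ} (hlam : 0 < lam) (φ : L2 n) :
    bargmannL hlam φ = (bargmann_mem_fockSpace hlam φ).2.toLp _ := rfl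

theorem inner_bargmannL {lam : ℝ} (hlam : 0 < lam) (φ ψ : L2 n) :
    inner ℂ (bargmannL hlam ψ) (bargmannL hlam φ) = inner ℂ ψ φ := by
  refine isClosed_property (dense_span_coherent hlam).denseRange_val
    (p := fun ψ => inner ℂ (bargmannL hlam ψ) (bargmannL hlam φ) = inner ℂ ψ φ)
    (isClosed_eq (by fun_prop) (by fun_prop)) (fun ψ => ?_) ψ
  rw [bargmannL_apply, bargmannL_apply, ← fockInner_eq_inner]
  exact fockInner_bargmann_of_mem_span hlam (bargmann_mem_fockSpace hlam φ) ψ.2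

theorem fockInner_bargmann {lam : ℝ} (hlam : 0 < lam) (φ ψ : L2 n) :
    fockInner n lam (bargmann lam φ) (bargmann lam ψ) = inner ℂ ψ φ := by
  rw [← inner_bargmannL hlam, bargmannL_apply, bargmannL_apply, ← fockInner_eq_inner]

theorem norm_bargmannL {lam : ℝ} (hlam : 0 < lam) (φ : L2 n) : ‖bargmannL hlam φ‖ = ‖φ‖ := by
  have h := inner_bargmannL hlam φ φ
  rw [inner_self_eq_norm_sq_to_K, inner_self_eq_norm_sq_to_K] at h
  refine (sq_eq_sq₀ (norm_nonneg _) (norm_nonneg _)).1 ?_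
  exact_mod_cast h

theorem eLpNorm_bargmann {lam : ℝ} (hlam : 0 < lam) (φ : L2 n) :
    eLpNorm (bargmann lam φ) 2 (fockMeasure n lam) = ENNReal.ofReal ‖φ‖ := by
  rw [← norm_bargmannL hlam, bargmannL_apply, Lp.norm_toLp,
    ENNReal.ofReal_toReal (bargmann_mem_fockSpace hlam φ).2.2.ne]

theorem exists_bargmann_eq {lam : ℝ} (hlam : 0 < lam) {f : (Fin n → ℂ) → ℂ}
    (hf : f ∈ fockSpace n lam) : ∃ ψ : L2 n, bargmann lam ψ = f := by
  set ψ := ContinuousLinearMap.adjoint (bargmannL hlam) (hf.2.toLp f) with hψ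
  refine ⟨ψ, ?_⟩
  have hB := bargmann_mem_fockSpace hlam ψ
  ext w
  rw [← sub_eq_zero]
  have h := fockInner_fockKernel hlam ((fockSpace n lam).sub_mem hB hf) w
  rw [Pi.sub_apply] at h
  rw [← h, fockInner_eq_inner (hB.2.sub hf.2) (fockKernel_mem_fockSpace hlam w).2,
    MemLp.toLp_sub hB.2 hf.2, inner_sub_right]
  have hk : (fockKernel_mem_fockSpace hlam w).2.toLp _ = bargmannL hlam (coherent hlam w) :=
    MemLp.toLp_congr _ (bargmann_mem_fockSpace hlam _).2
      (.of_forall fun z => by rw [bargmann_coherent_eq])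
  rw [hk, ← bargmannL_apply hlam, inner_bargmannL, hψ, ContinuousLinearMap.adjoint_inner_right, sub_self]

theorem bijOn_bargmann {lam : ℝ} (hlam : 0 < lam) :
    Set.BijOn (bargmann (n := n) lam) Set.univ (fockSpace n lam) :=
  ⟨fun φ _ => bargmann_mem_fockSpace hlam φ, (bargmann_injective hlam).injOn, fun _ hf =>
    let ⟨ψ, hψ⟩ := exists_bargmann_eq hlam hf
    ⟨ψ, trivial, hψ⟩⟩

theorem bargmann_bargmannInv {lam : ℝ} (hlam : 0 < lam) {f : (Fin n → ℂ) → ℂ}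
    (hf : f ∈ fockSpace n lam) : bargmann lam (bargmannInv lam f) = f :=
  Function.invFun_eq (exists_bargmann_eq hlam hf)

/-- The truncations of an `L²` function to balls converge to it. -/
theorem tendsto_eLpNorm_sub_indicator_closedBall (φ : L2 n) :
    Tendsto (fun R : ℝ => eLpNorm (fun x => φ x - (Metric.closedBall 0 R).indicator φ x) 2 volume)
      atTop (𝓝 0) := by
  have hfin : ∫⁻ x, ‖φ x‖ₑ ^ 2 ≠ ⊤ := by
    have h := lintegral_rpow_enorm_lt_top_of_eLpNorm_lt_top two_ne_zero ENNReal.ofNat_ne_top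
      (Lp.memLp φ).2
    simpa using h.ne
  have h : Tendsto (fun R : ℝ => ∫⁻ x, ‖φ x - (Metric.closedBall 0 R).indicator φ x‖ₑ ^ 2)
      atTop (𝓝 (∫⁻ _ : EuclideanSpace ℝ (Fin n), 0)) := by
    refine tendsto_lintegral_filter_of_dominated_convergence' (fun x => ‖φ x‖ₑ ^ 2)
      (.of_forall fun R => ?_) (.of_forall fun R => .of_forall fun x => ?_) hfin
      (.of_forall fun x => ?_)
    · exact (((Lp.aestronglyMeasurable φ).sub ((Lp.aestronglyMeasurable φ).indicator
        measurableSet_closedBall)).enorm.pow_const 2)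
    · by_cases hx : x ∈ Metric.closedBall 0 R <;> simp [hx]
    · refine tendsto_const_nhds.congr' ?_
      filter_upwards [eventually_ge_atTop ‖x‖] with R hR
      have : x ∈ Metric.closedBall 0 R := by simpa using hR
      simp [this]
  simp only [eLpNorm_eq_lintegral_rpow_enorm_toReal two_ne_zero ENNReal.ofNat_ne_top,
    ENNReal.toReal_ofNat, ENNReal.rpow_ofNat]
  rw [lintegral_zero] at h
  have := (ENNReal.continuous_rpow_const (y := 1 / 2)).tendsto 0 |>.comp h
  rwa [ENNReal.zero_rpow_of_pos (by norm_num)] at this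

/-- An isometry of `L²(ℝⁿ)` that the Bargmann transform carries into a weighted composition
operator has a bounded kernel `K` as soon as the two agree on the Gaussians `B(z,·)`. -/
theorem isKernel_of_integral_bargmannKernel_mul {lam : ℝ} (hlam : 0 < lam) {T : L2 n → L2 n}
    {c : (Fin n → ℂ) → ℂ} {g : (Fin n → ℂ) → Fin n → ℂ}
    (hT : ∀ φ z, bargmann lam (T φ) z = c z * bargmann lam φ (g z))
    (hnorm : ∀ φ, ‖T φ‖ = ‖φ‖)
    {K : EuclideanSpace ℝ (Fin n) → EuclideanSpace ℝ (Fin n) → ℂ}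
    (hK : Measurable (Function.uncurry K)) {C : ℝ} (hC : ∀ x y, ‖K x y‖ ≤ C)
    (hBK : ∀ z y, ∫ x, bargmannKernel lam z x * K x y = c z * bargmannKernel lam (g z) y) :
    IsKernel T K := by
  have hint : ∀ φ : L2 n, Integrable φ volume → ∀ x, Integrable (fun y => K x y * φ y) volume :=
    fun φ hφ x => hφ.bdd_mul (hK.comp measurable_prodMk_left).aestronglyMeasurable
      (.of_forall (hC x))
  have happly : ∀ φ : L2 n, Integrable φ volume → T φ =ᵐ[volume] fun x => ∫ y, K x y * φ y := by
    intro φ hφ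
    have hprod : ∀ z, Integrable (fun p : EuclideanSpace ℝ (Fin n) × EuclideanSpace ℝ (Fin n) =>
        bargmannKernel lam z p.1 * (K p.1 p.2 * φ p.2)) (volume.prod volume) := fun z => by
      refine (((integrable_bargmannKernel hlam z).mul_prod hφ).bdd_mul
        hK.aestronglyMeasurable (.of_forall fun p => hC p.1 p.2)).congr (.of_forall fun p => ?_)
      simp only [Function.uncurry]
      ring
    have hS : ∀ z, Integrable fun x => bargmannKernel lam z x * ∫ y, K x y * φ y := fun z => by
      simpa only [integral_const_mul] using (hprod z).integral_prod_left
    have hSz : ∀ z, ∫ x, bargmannKernel lam z x * ∫ y, K x y * φ y =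
        c z * bargmann lam φ (g z) := fun z => by
      simp only [← integral_const_mul]
      rw [integral_integral_swap (f := fun x y => bargmannKernel lam z x * (K x y * φ y)) (hprod z)]
      simp only [← mul_assoc, integral_mul_const, hBK]
      simp only [mul_assoc, integral_const_mul, bargmann]
    have hTint := fun z => integrable_bargmannKernel_mul_coeFn hlam z (T φ)
    have h0 := ae_eq_zero_of_integral_bargmannKernel_eq_zero hlam
      (h := fun x => T φ x - ∫ y, K x y * φ y)
      (by simpa only [mul_sub] using! (hTint 0).sub (hS 0)) fun z => by
        simp only [mul_sub]
        rw [integral_sub (hTint z) (hS z), hSz, ← hT, sub_eq_zero]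
        rfl
    filter_upwards [h0] with x hx
    exact sub_eq_zero.1 hx
  have hsub : ∀ φ ψ, T (φ - ψ) = T φ - T ψ := fun φ ψ => bargmann_injective hlam <| by
    ext z
    rw [bargmann_sub hlam, Pi.sub_apply, hT, hT, hT, bargmann_sub hlam, Pi.sub_apply, mul_sub]
  refine ⟨hK, fun φ hφ => .of_forall (hint φ hφ), happly, fun φ => ?_⟩
  refine (tendsto_eLpNorm_sub_indicator_closedBall φ).congr fun R => ?_
  have hmem : MemLp ((Metric.closedBall 0 R).indicator φ) 2 volume :=
    (Lp.memLp φ).indicator measurableSet_closedBall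
  set ψ : L2 n := hmem.toLp _ with hψdef
  have hψ : ψ =ᵐ[volume] (Metric.closedBall 0 R).indicator φ := hmem.coeFn_toLp
  have hψint : Integrable ψ volume := by
    refine Integrable.congr ?_ hψ.symm
    rw [integrable_indicator_iff measurableSet_closedBall]
    have : IsFiniteMeasure
        ((volume : Measure (EuclideanSpace ℝ (Fin n))).restrict (Metric.closedBall 0 R)) :=
      ⟨by simpa using measure_closedBall_lt_top⟩
    exact ((Lp.memLp φ).restrict _).integrable one_le_two
  have hTψ : ∀ᵐ x, T ψ x = ∫ y in Metric.closedBall 0 R, K x y * φ y := by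
    filter_upwards [happly ψ hψint] with x hx
    rw [hx, ← integral_indicator measurableSet_closedBall]
    refine integral_congr_ae ?_
    filter_upwards [hψ] with y hy
    rw [hy]
    by_cases hyR : y ∈ Metric.closedBall 0 R <;> simp [hyR]
  have e1 : eLpNorm (fun x => φ x - (Metric.closedBall 0 R).indicator φ x) 2 volume =
      ENNReal.ofReal ‖φ - ψ‖ := by
    rw [Lp.norm_def, ENNReal.ofReal_toReal (Lp.eLpNorm_ne_top _)]
    refine eLpNorm_congr_ae ?_
    filter_upwards [hψ, Lp.coeFn_sub φ ψ] with x h1 h2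
    rw [h2, Pi.sub_apply, h1]
  rw [e1, ← hnorm, hsub, Lp.norm_def, ENNReal.ofReal_toReal (Lp.eLpNorm_ne_top _)]
  refine eLpNorm_congr_ae ?_
  filter_upwards [hTψ, Lp.coeFn_sub (T φ) (T ψ)] with x h1 h2
  rw [h2, Pi.sub_apply, h1]

theorem bargmann_diamondRep' {lam : ℝ} (hlam : 0 < lam) (α : Fin n → Module.Dual ℝ (Fin m → ℝ))
    (χ : AddChar (Fin m → ℝ) Circle) (t : Fin m → ℝ) (z₀ : Fin n → ℂ) (c₀ : ℝ) (φ : L2 n) :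
    bargmann lam (diamondRep' lam α χ t z₀ c₀ φ) =
      diamondRep lam α χ t z₀ c₀ (bargmann lam φ) :=
  bargmann_bargmannInv hlam
    (rho_mem_fockSpace z₀ c₀ (sigma_mem_fockSpace α χ t (bargmann_mem_fockSpace hlam φ)))

theorem norm_diamondRep' {lam : ℝ} (hlam : 0 < lam) (α : Fin n → Module.Dual ℝ (Fin m → ℝ))
    (χ : AddChar (Fin m → ℝ) Circle) (t : Fin m → ℝ) (z₀ : Fin n → ℂ) (c₀ : ℝ) (φ : L2 n) :
    ‖diamondRep' lam α χ t z₀ c₀ φ‖ = ‖φ‖ := by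
  have hd := differentiable_bargmann hlam φ
  have h := eLpNorm_bargmann hlam (diamondRep' lam α χ t z₀ c₀ φ)
  rw [bargmann_diamondRep' hlam, diamondRep,
    eLpNorm_rho lam z₀ c₀ (differentiable_sigma α χ t hd).continuous,
    eLpNorm_sigma lam α χ t hd.continuous, eLpNorm_bargmann hlam] at h
  exact ((ENNReal.ofReal_eq_ofReal_iff (norm_nonneg _) (norm_nonneg _)).1 h).symm

theorem diamondRep'_zero (lam : ℝ) (α : Fin n → Module.Dual ℝ (Fin m → ℝ))
    (χ : AddChar (Fin m → ℝ) Circle) (t : Fin m → ℝ) :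
    diamondRep' lam α χ t 0 0 = sigma' lam α χ t := by
  ext1 φ
  rw [diamondRep', sigma', diamondRep]
  congr 1
  ext z
  simp [rho]

section scalar

variable {a : ℝ}

theorem exp_sq_sub_one (a : ℝ) : Complex.exp (-(Complex.I * a)) ^ 2 - 1 =
    -2 * Complex.I * Complex.sin a * Complex.exp (-(Complex.I * a)) := by
  rw [show -(Complex.I * (a : ℂ)) = (-(a : ℂ)) * Complex.I by ring, Complex.exp_mul_I,
    Complex.cos_neg, Complex.sin_neg]
  linear_combination Complex.sin_sq_add_cos_sq (a : ℂ) -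
    Complex.sin (a : ℂ) ^ 2 * Complex.I_sq

theorem exp_sq_sub_one_ne_zero (ha : Real.sin a ≠ 0) :
    Complex.exp (-(Complex.I * a)) ^ 2 - 1 ≠ 0 := by
  have hs : Complex.sin a ≠ 0 := by rw [← Complex.ofReal_sin]; exact_mod_cast ha
  rw [exp_sq_sub_one]
  simp [hs]

theorem inv_exp_sq_sub_one (ha : Real.sin a ≠ 0) :
    (Complex.exp (-(Complex.I * a)) ^ 2 - 1)⁻¹ =
      -1 / 2 + Complex.I / 2 * ((Real.cos a / Real.sin a : ℝ) : ℂ) := by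
  have hs : Complex.sin a ≠ 0 := by rw [← Complex.ofReal_sin]; exact_mod_cast ha
  refine inv_eq_of_mul_eq_one_right ?_
  rw [exp_sq_sub_one, show -(Complex.I * (a : ℂ)) = (-(a : ℂ)) * Complex.I by ring,
    Complex.exp_mul_I, Complex.cos_neg, Complex.sin_neg]
  push_cast
  field_simp
  linear_combination Complex.sin_sq_add_cos_sq (a : ℂ) -
    (Complex.cos (a : ℂ) ^ 2 + Complex.sin (a : ℂ) ^ 2 -
      Complex.I * Complex.cos (a : ℂ) * Complex.sin (a : ℂ)) * Complex.I_sq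

theorem two_mul_exp_mul_inv (ha : Real.sin a ≠ 0) :
    2 * Complex.exp (-(Complex.I * a)) * (Complex.exp (-(Complex.I * a)) ^ 2 - 1)⁻¹ =
      Complex.I * (((Real.sin a)⁻¹ : ℝ) : ℂ) := by
  have hs : Complex.sin a ≠ 0 := by rw [← Complex.ofReal_sin]; exact_mod_cast ha
  rw [exp_sq_sub_one]
  push_cast
  have := Complex.exp_ne_zero (-(Complex.I * a))
  have := Complex.I_ne_zero
  field_simp
  rw [Complex.I_sq]

end scalar

theorem sin_ne_zero_of_forall_ne {a : ℝ} (h : ∀ j : ℤ, a ≠ j * Real.pi) : Real.sin a ≠ 0 :=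
  fun h0 => (Real.sin_eq_zero_iff.1 h0).elim fun j hj => h j hj.symm

/-- The kernel `b_t` in terms of `q = e^{-iα(t)}`. -/
theorem mehler_eq (lam : ℝ) (α : Fin n → Module.Dual ℝ (Fin m → ℝ))
    (χ : AddChar (Fin m → ℝ) Circle) (t : Fin m → ℝ) (ht : ∀ k, Real.sin (α k t) ≠ 0)
    (q : Fin n → ℂ) (hq : q = fun k => Complex.exp (-(Complex.I * (α k t : ℝ))))
    (x y : EuclideanSpace ℝ (Fin n)) :
    mehler lam α χ t x y = (((lam / Real.pi) ^ ((n : ℝ) / 2) : ℝ) : ℂ) * (χ t : ℂ)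
      * (∏ k, (1 - q k ^ 2) ^ (-(1 / 2) : ℂ))
      * Complex.exp (∑ k, (lam * ((q k ^ 2 - 1)⁻¹ + 1 / 2) * ((x k : ℂ) ^ 2 + (y k : ℂ) ^ 2)
          - lam * (2 * q k * (q k ^ 2 - 1)⁻¹) * (x k * y k))) := by
  rw [mehler]
  congr 1
  · congr 1
    refine Finset.prod_congr rfl fun k _ => ?_
    rw [hq, ← Complex.exp_nat_mul]
    congr 3
    push_cast
    ring
  · congr 1
    rw [Finset.sum_sub_distrib, Finset.mul_sum, Finset.mul_sum]
    congr 1 <;> refine Finset.sum_congr rfl fun k _ => ?_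
    · rw [hq]
      simp only [inv_exp_sq_sub_one (ht k)]
      rw [Complex.ofReal_mul]
      push_cast
      ring
    · rw [hq]
      simp only [two_mul_exp_mul_inv (ht k)]
      rw [Complex.ofReal_mul]
      push_cast
      ring

theorem form_diagonal (d : Fin n → ℂ) (x y : EuclideanSpace ℝ (Fin n)) :
    form (Matrix.diagonal d) x y = ∑ k, (x k : ℂ) * (d k * y k) := by
  simp [form, dotProduct, Matrix.mulVec_diagonal]

theorem detInvSqrt_diagonal (d : Fin n → ℂ) :
    detInvSqrt (Matrix.diagonal d) = ∏ k, d k ^ (-(1 / 2) : ℂ) := by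
  rw [detInvSqrt, Matrix.charpoly_diagonal, Polynomial.roots_prod _ _
    (Finset.prod_ne_zero_iff.2 fun k _ => Polynomial.X_sub_C_ne_zero _)]
  simp only [Polynomial.roots_X_sub_C, Multiset.bind_singleton, Multiset.map_map,
    Function.comp_def, Finset.prod]

theorem mehlerMatrix_eq_mehler (lam : ℝ) (α : Fin n → Module.Dual ℝ (Fin m → ℝ))
    (χ : AddChar (Fin m → ℝ) Circle) (t : Fin m → ℝ) (ht : ∀ k, Real.sin (α k t) ≠ 0)
    (x y : EuclideanSpace ℝ (Fin n)) :
    mehlerMatrix lam α χ t x y = mehler lam α χ t x y := by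
  set q : Fin n → ℂ := fun k => Complex.exp (-(Complex.I * (α k t : ℝ))) with hq
  have hq1 : ∀ k, q k ^ 2 - 1 ≠ 0 := fun k => exp_sq_sub_one_ne_zero (ht k)
  have hA : actMatrix α (-t) = Matrix.diagonal q := by
    simp [actMatrix, hq]
  have hone : (1 : Matrix (Fin n) (Fin n) ℂ) = Matrix.diagonal fun _ => 1 :=
    Matrix.diagonal_one.symm
  have h1 : actMatrix α (-t) ^ 2 - 1 = Matrix.diagonal fun k => q k ^ 2 - 1 := by
    rw [hA, Matrix.diagonal_pow, hone, Matrix.diagonal_sub]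
    rfl
  have h2 : 1 - actMatrix α (-t) ^ 2 = Matrix.diagonal fun k => 1 - q k ^ 2 := by
    rw [hA, Matrix.diagonal_pow, hone, Matrix.diagonal_sub]
    rfl
  have h3 : (actMatrix α (-t) ^ 2 - 1)⁻¹ = Matrix.diagonal fun k => (q k ^ 2 - 1)⁻¹ := by
    refine Matrix.inv_eq_right_inv ?_
    rw [h1, Matrix.diagonal_mul_diagonal, hone]
    simp only [mul_inv_cancel₀ (hq1 _)]
  rw [mehler_eq lam α χ t ht q hq, mehlerMatrix, h3, h2, hA, Matrix.diagonal_mul_diagonal,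
    detInvSqrt_diagonal, form_diagonal, form_diagonal, form_diagonal, mul_assoc _ (Complex.exp _),
    ← Complex.exp_add]
  congr 2
  simp only [Finset.mul_sum, ← Finset.sum_add_distrib, ← Finset.sum_sub_distrib]
  refine Finset.sum_congr rfl fun k _ => ?_
  ring

theorem norm_mehler (lam : ℝ) (α : Fin n → Module.Dual ℝ (Fin m → ℝ))
    (χ : AddChar (Fin m → ℝ) Circle) (t : Fin m → ℝ) (x y : EuclideanSpace ℝ (Fin n)) :
    ‖mehler lam α χ t x y‖ = ‖(((lam / Real.pi) ^ ((n : ℝ) / 2) : ℝ) : ℂ) * (χ t : ℂ)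
      * (∏ k, (1 - Complex.exp (-2 * Complex.I * (α k t : ℝ))) ^ (-(1 / 2) : ℂ))‖ := by
  rw [mehler, norm_mul]
  have h : ∀ r s : ℝ, ‖Complex.exp (Complex.I * (lam / 2) * r - Complex.I * lam * s)‖ = 1 :=
    fun r s => by
      rw [show Complex.I * (lam / 2) * r - Complex.I * lam * s =
        ((lam / 2 * r - lam * s : ℝ) : ℂ) * Complex.I by push_cast; ring,
        Complex.norm_exp_ofReal_mul_I]
  rw [← Complex.ofReal_sum, ← Complex.ofReal_sum, h, mul_one]

theorem continuous_mehler (lam : ℝ) (α : Fin n → Module.Dual ℝ (Fin m → ℝ))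
    (χ : AddChar (Fin m → ℝ) Circle) (t : Fin m → ℝ) {X : Type*} [TopologicalSpace X]
    {f g : X → EuclideanSpace ℝ (Fin n)} (hf : Continuous f) (hg : Continuous g) :
    Continuous fun p => mehler lam α χ t (f p) (g p) := by
  unfold mehler
  fun_prop

/-- The Gaussian integral behind the kernel of `σ'(t)`. -/
theorem integral_bargmannKernel_mul_mehler {lam : ℝ} (hlam : 0 < lam)
    (α : Fin n → Module.Dual ℝ (Fin m → ℝ)) (χ : AddChar (Fin m → ℝ) Circle) (t : Fin m → ℝ)
    (ht : ∀ k, Real.sin (α k t) ≠ 0) (z : Fin n → ℂ) (y : EuclideanSpace ℝ (Fin n)) :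
    ∫ x, bargmannKernel lam z x * mehler lam α χ t x y =
      (χ t : ℂ) * bargmannKernel lam (act α (-t) z) y := by
  set q : Fin n → ℂ := fun k => Complex.exp (-(Complex.I * (α k t : ℝ))) with hq
  have hl : (lam : ℂ) ≠ 0 := by exact_mod_cast hlam.ne'
  have hpi := Real.pi_pos
  have hq1 : ∀ k, q k ^ 2 - 1 ≠ 0 := fun k => exp_sq_sub_one_ne_zero (ht k)
  have hq2 : ∀ k, 1 - q k ^ 2 ≠ 0 := fun k h => hq1 k (by linear_combination -h)
  have hact : act α (-t) z = fun k => q k * z k := by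
    ext k
    simp [act, hq]
  set b : Fin n → ℂ := fun k => -(lam * (q k ^ 2 - 1)⁻¹) with hb
  set c : Fin n → ℂ := fun k => lam * z k - lam * (2 * q k * (q k ^ 2 - 1)⁻¹) * y k with hc
  have hbre : ∀ k, 0 < (b k).re := fun k => by
    simp only [hb, hq, inv_exp_sq_sub_one (ht k)]
    rw [Complex.neg_re, Complex.re_ofReal_mul, Complex.add_re,
      show (Complex.I / 2 : ℂ) * ((Real.cos (α k t) / Real.sin (α k t) : ℝ) : ℂ) =
        ((Real.cos (α k t) / Real.sin (α k t) / 2 : ℝ) : ℂ) * Complex.I by push_cast; ring,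
      Complex.re_ofReal_mul, Complex.I_re]
    norm_num
    positivity
  have hsqrt : ∀ k, (Real.pi / b k) ^ (1 / 2 : ℂ) =
      (((Real.pi / lam) ^ (1 / 2 : ℝ) : ℝ) : ℂ) * (1 - q k ^ 2) ^ (1 / 2 : ℂ) := fun k => by
    have : Real.pi / b k = ((Real.pi / lam : ℝ) : ℂ) * (1 - q k ^ 2) := by
      simp only [hb]
      have := hq1 k
      push_cast
      field_simp
      ring
    have hpl : 0 < Real.pi / lam := by positivity
    have hpl' : ((Real.pi / lam : ℝ) : ℂ) ≠ 0 := by exact_mod_cast hpl.ne'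
    rw [this, Complex.ofReal_cpow hpl.le, Complex.cpow_def_of_ne_zero (mul_ne_zero hpl' (hq2 k)),
      Complex.cpow_def_of_ne_zero hpl', Complex.cpow_def_of_ne_zero (hq2 k), ← Complex.exp_add,
      Complex.log_ofReal_mul hpl (hq2 k), Complex.ofReal_log hpl.le]
    push_cast
    ring_nf
  have hone : (((lam / Real.pi) ^ ((n : ℝ) / 2) : ℝ) : ℂ) *
      (∏ k, (1 - q k ^ 2) ^ (-(1 / 2) : ℂ)) * ∏ k, (Real.pi / b k) ^ (1 / 2 : ℂ) = 1 := by
    have h1 : ∀ k, (1 - q k ^ 2) ^ (-(1 / 2) : ℂ) * (1 - q k ^ 2) ^ (1 / 2 : ℂ) = 1 := fun k => by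
      rw [← Complex.cpow_add _ _ (hq2 k), neg_add_cancel, Complex.cpow_zero]
    have h2 : (lam / Real.pi) ^ ((n : ℝ) / 2) * ((Real.pi / lam) ^ (1 / 2 : ℝ)) ^ n = 1 := by
      rw [← Real.rpow_natCast, ← Real.rpow_mul (by positivity), ← inv_div lam,
        Real.inv_rpow (by positivity), show 1 / 2 * (n : ℝ) = n / 2 by ring]
      exact mul_inv_cancel₀ (by positivity)
    simp only [hsqrt, Finset.prod_mul_distrib, Finset.prod_const, Finset.card_univ,
      Fintype.card_fin]
    rw [show ∀ d p s r : ℂ, d * p * (s * r) = (d * s) * (p * r) by intros; ring,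
      ← Finset.prod_mul_distrib, ← Complex.ofReal_pow, ← Complex.ofReal_mul, h2]
    simp only [h1, Finset.prod_const_one, Complex.ofReal_one, mul_one]
  have hfun : ∀ x : EuclideanSpace ℝ (Fin n), bargmannKernel lam z x * mehler lam α χ t x y =
      ((((lam / Real.pi) ^ ((n : ℝ) / 4) : ℝ) : ℂ) *
        ((((lam / Real.pi) ^ ((n : ℝ) / 2) : ℝ) : ℂ) * (χ t : ℂ)
          * (∏ k, (1 - q k ^ 2) ^ (-(1 / 2) : ℂ))) *
        Complex.exp (∑ k, (-(lam / 4) * z k ^ 2 +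
          lam * ((q k ^ 2 - 1)⁻¹ + 1 / 2) * (y k : ℂ) ^ 2))) *
      Complex.exp (-∑ k, b k * (x k : ℂ) ^ 2 + ∑ k, c k * x k) := fun x => by
    rw [mehler_eq lam α χ t ht q hq, bargmannKernel, mul_mul_mul_comm, ← Complex.exp_add,
      mul_assoc _ (Complex.exp _), ← Complex.exp_add]
    congr 2
    simp only [hb, hc, Finset.mul_sum, ← Finset.sum_add_distrib, ← Finset.sum_sub_distrib,
      ← Finset.sum_neg_distrib]
    refine Finset.sum_congr rfl fun k _ => ?_
    ring
  simp only [hfun]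
  rw [integral_const_mul, integral_cexp_gaussian hbre, Finset.prod_mul_distrib, ← Complex.exp_sum,
    show ∀ a d x p e s f : ℂ, a * (d * x * p) * e * (s * f) = (d * p * s) * (x * (a * (e * f))) by
      intros; ring, hone, one_mul, ← Complex.exp_add, bargmannKernel, hact]
  congr 3
  simp only [Finset.mul_sum, ← Finset.sum_add_distrib, ← Finset.sum_sub_distrib]
  refine Finset.sum_congr rfl fun k _ => ?_
  simp only [hb, hc]
  have := hq1 k
  field_simp
  ring

/-- The Gaussians `B(z,·)` intertwine the Bargmann–Fock and the Schrödinger representation. -/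
theorem bargmannKernel_add_mul_exp (lam : ℝ) (a b x : EuclideanSpace ℝ (Fin n)) (c : ℝ)
    (z z₀ : Fin n → ℂ) (hz₀ : z₀ = fun k => (a k : ℂ) + Complex.I * (b k : ℂ)) :
    bargmannKernel lam z (x + a) * Complex.exp (Complex.I * lam *
        ((c - ∑ k, b k * (x + a) k + (1 / 2) * ∑ k, a k * b k : ℝ) : ℂ)) =
      Complex.exp (Complex.I * lam * c + (lam / 2) * ∑ k, starRingEnd ℂ (z₀ k) * z k
        - (lam / 4) * ∑ k, (‖z₀ k‖ : ℂ) ^ 2) * bargmannKernel lam (z - z₀) x := by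
  rw [bargmannKernel, bargmannKernel, mul_left_comm, mul_assoc, ← Complex.exp_add,
    ← Complex.exp_add]
  congr 2
  have h : ∀ E F : ℂ, E = F → Complex.I * lam * c + E = Complex.I * lam * c + F :=
    fun E F h => by rw [h]
  push_cast
  rw [show ∀ A S T : ℂ, A + Complex.I * lam * (c - S + 1 / 2 * T) =
    Complex.I * lam * c + (A - Complex.I * lam * S + Complex.I * lam * (1 / 2) * T) by
      intros; ring, add_sub_assoc (Complex.I * lam * c), add_assoc (Complex.I * lam * c)]
  refine h _ _ ?_
  simp only [← Complex.conj_mul', hz₀, Finset.mul_sum, ← Finset.sum_add_distrib,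
    ← Finset.sum_sub_distrib, PiLp.add_apply, Pi.sub_apply, map_add, map_mul, Complex.conj_I,
    Complex.conj_ofReal, Complex.ofReal_add]
  refine Finset.sum_congr rfl fun k _ => ?_
  ring

theorem isKernel_diamondRep' {lam : ℝ} (hlam : 0 < lam) (α : Fin n → Module.Dual ℝ (Fin m → ℝ))
    (χ : AddChar (Fin m → ℝ) Circle) (t : Fin m → ℝ) (ht : ∀ k, Real.sin (α k t) ≠ 0)
    (a b : EuclideanSpace ℝ (Fin n)) (c : ℝ) :
    IsKernel (diamondRep' lam α χ t (fun k => (a k : ℂ) + Complex.I * (b k : ℂ)) c)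
      (fun x y => Complex.exp (Complex.I * lam *
          ((c - ∑ k, b k * x k + (1 / 2) * ∑ k, a k * b k : ℝ) : ℂ))
        * mehler lam α χ t (x - a) y) := by
  set z₀ : Fin n → ℂ := fun k => (a k : ℂ) + Complex.I * (b k : ℂ) with hz₀
  refine isKernel_of_integral_bargmannKernel_mul hlam
    (c := fun z => Complex.exp (Complex.I * lam * c + (lam / 2) * ∑ k, starRingEnd ℂ (z₀ k) * z k
      - (lam / 4) * ∑ k, (‖z₀ k‖ : ℂ) ^ 2) * (χ t : ℂ))
    (g := fun z => act α (-t) (z - z₀))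
    (C := ‖(((lam / Real.pi) ^ ((n : ℝ) / 2) : ℝ) : ℂ) * (χ t : ℂ)
      * (∏ k, (1 - Complex.exp (-2 * Complex.I * (α k t : ℝ))) ^ (-(1 / 2) : ℂ))‖)
    (fun φ z => ?_) (norm_diamondRep' hlam α χ t z₀ c) ?_ (fun x y => ?_) fun z y => ?_
  · rw [bargmann_diamondRep' hlam, diamondRep, rho, sigma]
    exact (mul_assoc _ _ _).symm
  · have h1 : Continuous fun x : EuclideanSpace ℝ (Fin n) => Complex.exp (Complex.I * lam *
        ((c - ∑ k, b k * x k + (1 / 2) * ∑ k, a k * b k : ℝ) : ℂ)) := by fun_prop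
    have h2 : Continuous fun p : EuclideanSpace ℝ (Fin n) × EuclideanSpace ℝ (Fin n) =>
        mehler lam α χ t (p.1 - a) p.2 :=
      continuous_mehler lam α χ t (continuous_fst.sub continuous_const) continuous_snd
    exact ((h1.comp continuous_fst).mul h2).measurable
  · rw [norm_mul, norm_mehler, mul_assoc Complex.I, ← Complex.ofReal_mul, norm_exp_I_mul, one_mul]
  · rw [← integral_add_right_eq_self _ a]
    simp only [add_sub_cancel_right, ← mul_assoc, bargmannKernel_add_mul_exp lam a b _ c z z₀ hz₀]
    simp only [mul_assoc, integral_const_mul,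
      integral_bargmannKernel_mul_mehler hlam α χ t ht (z - z₀) y]

theorem isKernel_sigma' {lam : ℝ} (hlam : 0 < lam) (α : Fin n → Module.Dual ℝ (Fin m → ℝ))
    (χ : AddChar (Fin m → ℝ) Circle) (t : Fin m → ℝ) (ht : ∀ k, Real.sin (α k t) ≠ 0) :
    IsKernel (sigma' lam α χ t) (mehler lam α χ t) := by
  have h := isKernel_diamondRep' hlam α χ t ht 0 0 0
  rw [← diamondRep'_zero]
  convert! h using 1
  · congr 1
    ext k
    simp
  · ext x y
    simp

end Diamond

end

theorem mainTheorem9 {m n : ℕ} (lam : ℝ) (hlam : 0 < lam)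
    (α : Fin n → Module.Dual ℝ (Fin m → ℝ)) (χ : AddChar (Fin m → ℝ) Circle) :
    -- the Bargmann transform is unitary from `L²(ℝⁿ)` onto the Fock space, which the operators
    -- `σ(t)` and `π(g)` preserve, so that `σ'(t)` and `π'(g)` are well defined
    (Set.BijOn (Diamond.bargmann (n := n) lam) Set.univ (Diamond.fockSpace n lam) ∧
      (∀ φ ψ : Diamond.L2 n,
        Diamond.fockInner n lam (Diamond.bargmann lam φ) (Diamond.bargmann lam ψ) = inner ℂ ψ φ) ∧
      (∀ t : Fin m → ℝ, Set.MapsTo (Diamond.sigma α χ t)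
        (Diamond.fockSpace n lam) (Diamond.fockSpace n lam)) ∧
      (∀ (t : Fin m → ℝ) (z₀ : Fin n → ℂ) (c₀ : ℝ),
        Set.MapsTo (Diamond.diamondRep lam α χ t z₀ c₀)
          (Diamond.fockSpace n lam) (Diamond.fockSpace n lam))) ∧
    ∀ t : Fin m → ℝ, (∀ (k : Fin n) (j : ℤ), α k t ≠ j * Real.pi) →
      -- the kernel of `σ'(t)`, in both forms
      Diamond.IsKernel (Diamond.sigma' lam α χ t) (Diamond.mehlerMatrix lam α χ t) ∧
      (∀ x y : EuclideanSpace ℝ (Fin n),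
        Diamond.mehlerMatrix lam α χ t x y = Diamond.mehler lam α χ t x y) ∧
      Diamond.IsKernel (Diamond.sigma' lam α χ t) (Diamond.mehler lam α χ t) ∧
      -- the kernel of `π'(g)` for `g = (t, a + ib, c)`
      ∀ (a b : EuclideanSpace ℝ (Fin n)) (c : ℝ),
        Diamond.IsKernel
          (Diamond.diamondRep' lam α χ t (fun k => (a k : ℂ) + Complex.I * (b k : ℂ)) c)
          (fun x y =>
            Complex.exp (Complex.I * lam *
              ((c - ∑ k, b k * x k + (1 / 2) * ∑ k, a k * b k : ℝ) : ℂ))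
            * Diamond.mehler lam α χ t (x - a) y) := by
  refine ⟨⟨Diamond.bijOn_bargmann hlam, Diamond.fockInner_bargmann hlam,
    fun t _ hf => Diamond.sigma_mem_fockSpace α χ t hf, fun t z₀ c₀ _ hf =>
      Diamond.rho_mem_fockSpace z₀ c₀ (Diamond.sigma_mem_fockSpace α χ t hf)⟩, fun t ht => ?_⟩
  have hs : ∀ k, Real.sin (α k t) ≠ 0 := fun k => Diamond.sin_ne_zero_of_forall_ne (ht k)
  have heq : Diamond.mehlerMatrix lam α χ t = Diamond.mehler lam α χ t :=
    funext₂ (Diamond.mehlerMatrix_eq_mehler lam α χ t hs)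
  refine ⟨?_, Diamond.mehlerMatrix_eq_mehler lam α χ t hs, Diamond.isKernel_sigma' hlam α χ t hs,
    Diamond.isKernel_diamondRep' hlam α χ t hs⟩
  rw [heq]
  exact Diamond.isKernel_sigma' hlam α χ t hs
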